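/- Let $a,b\in\mathbb R$ and $\sigma,P,\gamma>0$. Consider the Gaussian relay channel $y_r[i]=a x_s[i]+w_r[i]$, $y_d[i]=x_s[i]+b x_r[i]+w_d[i]$ with independent white noises of variance $\sigma^2$, and a relay that applies a stable, possibly noncausal, LTI filter, $x_r[i]=\sum_j h_j y_r[i-j]$ with $\sum_j|h_j|<\infty$. For block length $n$ let $\mathbf H_n=[h_{i-j}]_{i,j=1}^n$ and let the input be Gaussian, $\mathbf x\sim\mathcal N(0,\mathbf\Sigma_n)$, with $\mathbf\Sigma_n$ Hermitian positive semidefinite and Toeplitz. The pair $(\mathbf\Sigma_n,\mathbf H_n)$ is admissible if $\mathrm{tr}\,\mathbf\Sigma_n\le nP$ and $\mathrm{tr}(\mathbf H_n(a^2\mathbf\Sigma_n+\sigma^2\mathbf I)\mathbf H_n^H)\le n\gamma P$. Its rate is $$\frac1n I(\mathbf x;\mathbf y)=\frac1{2n}\log\frac{|(\mathbf I+ab\mathbf H_n)\mathbf\Sigma_n(\mathbf I+ab\mathbf H_n)^H+\sigma^2(\mathbf I+b^2\mathbf H_n\mathbf H_n^H)|}{|\sigma^2(\mathbf I+b^2\mathbf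 H_n\mathbf H_n^H)|},$$ where $\mathbf y=\mathbf x+b\mathbf H_n(a\mathbf x+\mathbf w_r)+\mathbf w_d$ is the received block. For real signals and filters the rate is the mutual information $\frac1n I(\mathbf x;\mathbf y)$; for complex ones it is the log-determinant expression. The LTI-relaying capacity is the limit as $n\to\infty$ of the supremum of the rate over the admissible pairs. For $m\ge 0$, an $m$-gain strategy consists of $\tau_0,\dots,\tau_m\ge0$ with $\sum\tau_j=1$, $\theta_0,\dots,\theta_m\ge0$ with $\sum\theta_j=1$, and gains $\lambda_1,\dots,\lambda_m$. Put $\mathcal C(x)=\frac12\log(1+x)$. The rate and the relay power of the strategy are $$R=\tau_0\,\mathcal C\Big(\frac{\theta_0P}{\tau_0\sigma^2}\Big)+\sum_{j=1}^{m}\tau_j\,\mathcal C\Big(\frac{\theta_j}{\tau_j}\frac P{\sigma^2}\frac{|1+ab\lambda_j|^2}{1+b^2|\lambda_j|^2}\Big),\qquad Q=\sum_{j=1}^m\tau_j|\lambda_j|^2\Big(\frac{a^2\theta_jP}{\tau_j}+\sigma^2\Big),$$ where terms with $\tau_j=0$ are $0$. Then there is a real number $C$ such that: 1. The limit defining the capacity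 exists and equals $C$, both for complex filters and input covariances and for real ones. 2. $C$ is the maximum of $R$ over all $7$-gain strategies with real gains and $Q\le\gamma P$. It is also the supremum of $R$ over all $7$-gain strategies with real gains and $Q=\gamma P$, and this supremum is a maximum whenever $b^2\gamma P\le a^2(a^2P+\sigma^2)$. 3. Every $m$-gain strategy, for any $m$, with complex gains and $Q\le\gamma P$ has $R\le C$. Thus real gains suffice. 4. If $b\neq0$, there is one polynomial $p\in\mathbb R[x]$ of degree $7$ such that in every strategy with real gains (any $m$), $Q\le\gamma P$ and $R=C$, each gain $\lambda_j$ with $\tau_j,\theta_j>0$ is a root of $p$. If moreover $b^2\gamma P<a^2(a^2P+\sigma^2)$, then for some $\alpha\ge0$, $\beta>0$ one can take, with $A=\alpha+\beta a^2x^2$, $L=1+abx$ and $N=1+b^2x^2$, $$p(x)=(L^2-2\sigma^2AN)\big(b(a-bx)A-\beta a^2xLN\big)-2\beta\sigma^2A\,x\,L^3N .$$ 5. There is a $7$-gain strategy with real gains, $Q\le\gamma P$, $R=C$ and $ab\lambda_j\ge0$ for all $j$, with the following property. Split $[0,2\pi)$ into eight consecutive subbands of lengths $2\pi\tau_0,\dots,2\pi\tau_7$.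 On subband $j$ let the input spectrum $f$ be $\theta_jP/\tau_j$ and let the relay frequency response $H$ be $\lambda_j$, with $\lambda_0=0$. Then $\frac1{2\pi}\int_0^{2\pi} f\le P$, $\frac1{2\pi}\int_0^{2\pi}(a^2f+\sigma^2)H^2\le\gamma P$, and $\frac1{4\pi}\int_0^{2\pi}\log\Big(1+\frac{f(1+abH)^2}{\sigma^2(1+b^2H^2)}\Big)d\omega=C$. -/

import Mathlib

open MeasureTheory ProbabilityTheory Filter Topology Polynomial
open scoped ENNReal Matrix ComplexOrder

noncomputable section

namespace LTIRelay

/-! ### Block model -/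

/-- The `n × n` Toeplitz matrix with `(i, j)` entry `c (i - j)`. -/
def toeplitz {𝕜 : Type*} (c : ℤ → 𝕜) (n : ℕ) : Matrix (Fin n) (Fin n) 𝕜 :=
  Matrix.of fun i j => c ((i : ℤ) - (j : ℤ))

/-- Admissible pairs (input covariance matrix `S`, relay matrix `H`) for block length `n`:
`S` is a positive semidefinite (in particular Hermitian) Toeplitz matrix, `H` is the `n × n` section
of a stable, possibly noncausal, LTI filter, the source satisfies `tr S ≤ n P`, and the relay
satisfies `tr (H (a² S + σ² I) Hᴴ) ≤ n γ P`. -/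
structure Admissible {𝕜 : Type*} [RCLike 𝕜] (a σ P γ : ℝ) (n : ℕ)
    (S H : Matrix (Fin n) (Fin n) 𝕜) : Prop where
  stationary : ∃ r : ℤ → 𝕜, S = toeplitz r n
  posSemidef : S.PosSemidef
  stable : ∃ h : ℤ → 𝕜, (Summable fun j => ‖h j‖) ∧ H = toeplitz h n
  source_power : RCLike.re S.trace ≤ n * P
  relay_power :
    RCLike.re (H * (((a ^ 2 : ℝ) : 𝕜) • S + ((σ ^ 2 : ℝ) : 𝕜) • 1) * Hᴴ).trace ≤ n * (γ * P)

/-- Covariance `σ² (I + b² H Hᴴ)` of the total noise at the destination. -/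
def noiseCov {𝕜 : Type*} [RCLike 𝕜] (b σ : ℝ) {n : ℕ} (H : Matrix (Fin n) (Fin n) 𝕜) :
    Matrix (Fin n) (Fin n) 𝕜 :=
  ((σ ^ 2 : ℝ) : 𝕜) • (1 + ((b ^ 2 : ℝ) : 𝕜) • (H * Hᴴ))

/-- Source-to-destination channel matrix `I + ab H`. -/
def channelMatrix {𝕜 : Type*} [RCLike 𝕜] (a b : ℝ) {n : ℕ} (H : Matrix (Fin n) (Fin n) 𝕜) :
    Matrix (Fin n) (Fin n) 𝕜 :=
  1 + ((a * b : ℝ) : 𝕜) • H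

/-- The transmission rate of a block,
`(1/2n) log (|(I + abH) S (I + abH)ᴴ + σ²(I + b²HHᴴ)| / |σ²(I + b²HHᴴ)|)`.
Both determinants are positive reals when `S` is positive semidefinite and `σ ≠ 0`. -/
def blockRate {𝕜 : Type*} [RCLike 𝕜] (a b σ : ℝ) {n : ℕ} (S H : Matrix (Fin n) (Fin n) 𝕜) : ℝ :=
  1 / (2 * n) * Real.log
    (RCLike.re (channelMatrix a b H * S * (channelMatrix a b H)ᴴ + noiseCov b σ H).det /
      RCLike.re (noiseCov b σ H).det)

/-- `C` is the LTI-relaying capacity for complex-valued signals and filters: the limit, as the block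
length tends to infinity, of the supremum of `blockRate` over all admissible pairs. The definition
includes that these suprema are finite and that the limit exists. -/
def IsLTICapacity (a b σ P γ C : ℝ) : Prop :=
  ∃ c : ℕ → ℝ,
    (∀ n : ℕ, 0 < n → IsLUB
      {R : ℝ | ∃ S H : Matrix (Fin n) (Fin n) ℂ, Admissible a σ P γ n S H ∧ R = blockRate a b σ S H}
      (c n)) ∧
    Tendsto c atTop (𝓝 C)

/-! ### Real signals: rate as mutual information -/

/-- Mutual information (in nats) of the two coordinates of a joint law `μ`. -/
def mutualInformation {X Y : Type*} [MeasurableSpace X] [MeasurableSpace Y]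
    (μ : Measure (X × Y)) : ℝ≥0∞ :=
  InformationTheory.klDiv μ (μ.fst.prod μ.snd)

/-- Joint law of the source block `x ∼ N(0, S)` and of the destination block
`y = x + b H (a x + w_r) + w_d`, where `w_r, w_d ∼ N(0, σ² I)` and `x, w_r, w_d` are
independent. -/
def jointLaw (a b σ : ℝ) {n : ℕ} (S H : Matrix (Fin n) (Fin n) ℝ) :
    Measure (EuclideanSpace ℝ (Fin n) × EuclideanSpace ℝ (Fin n)) :=
  ((multivariateGaussian 0 S).prod
    ((multivariateGaussian 0 (σ ^ 2 • (1 : Matrix (Fin n) (Fin n) ℝ))).prod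
      (multivariateGaussian 0 (σ ^ 2 • (1 : Matrix (Fin n) (Fin n) ℝ))))).map
    fun z => (z.1, z.1 + b • Matrix.toEuclideanCLM (𝕜 := ℝ) H (a • z.1 + z.2.1) + z.2.2)

/-- Largest value of `(1/n) I(x; y)` over the admissible pairs, for real signals and filters. -/
def blockCapacity (a b σ P γ : ℝ) (n : ℕ) : ℝ≥0∞ :=
  ⨆ (S : Matrix (Fin n) (Fin n) ℝ) (H : Matrix (Fin n) (Fin n) ℝ) (_ : Admissible a σ P γ n S H),
    mutualInformation (jointLaw a b σ S H) / n

/-! ### Finite-letter expression -/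

/-- `𝒞(x) = (1/2) log (1 + x)`. -/
def gaussCap (x : ℝ) : ℝ := 1 / 2 * Real.log (1 + x)

/-- The factor `|1 + ab l|² / (1 + b² |l|²)` by which an instantaneous amplify-and-forward relay of
gain `l` multiplies the direct-link SNR. -/
def iafFactor {𝕜 : Type*} [RCLike 𝕜] (a b : ℝ) (l : 𝕜) : ℝ :=
  ‖1 + ((a * b : ℝ) : 𝕜) * l‖ ^ 2 / (1 + b ^ 2 * ‖l‖ ^ 2)

/-- `τ` (bandwidth fractions) and `θ` (source power fractions) of modes `0, …, m`. -/
structure IsSplit {m : ℕ} (τ θ : Fin (m + 1) → ℝ) : Prop where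
  tau_nonneg : ∀ j, 0 ≤ τ j
  theta_nonneg : ∀ j, 0 ≤ θ j
  tau_sum : ∑ j, τ j = 1
  theta_sum : ∑ j, θ j = 1

/-- Rate of a direct-only mode `0` and `m` modes with relay gains `l`. A mode with `τ j = 0`
contributes `0`, the limit of its term as `τ j` decreases to `0`. -/
def modeRate {𝕜 : Type*} [RCLike 𝕜] (a b σ P : ℝ) {m : ℕ} (τ θ : Fin (m + 1) → ℝ)
    (l : Fin m → 𝕜) : ℝ :=
  τ 0 * gaussCap (θ 0 * P / (τ 0 * σ ^ 2)) +
    ∑ j : Fin m, τ j.succ *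
      gaussCap (θ j.succ / τ j.succ * (P / σ ^ 2) * iafFactor a b (l j))

/-- Power spent by the relay. -/
def modeRelayPower {𝕜 : Type*} [RCLike 𝕜] (a σ P : ℝ) {m : ℕ} (τ θ : Fin (m + 1) → ℝ)
    (l : Fin m → 𝕜) : ℝ :=
  ∑ j : Fin m, τ j.succ * ‖l j‖ ^ 2 * (a ^ 2 * θ j.succ * P / τ j.succ + σ ^ 2)

/-- Rates of one direct-only mode and `m` real gains, relay power at most `γ P`. -/
def modeRates (a b σ P γ : ℝ) (m : ℕ) : Set ℝ :=
  {R | ∃ (τ θ : Fin (m + 1) → ℝ) (l : Fin m → ℝ), IsSplit τ θ ∧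
    modeRelayPower a σ P τ θ l ≤ γ * P ∧ R = modeRate a b σ P τ θ l}

/-- Rates of one direct-only mode and `m` real gains, relay power exactly `γ P`. -/
def modeRatesEq (a b σ P γ : ℝ) (m : ℕ) : Set ℝ :=
  {R | ∃ (τ θ : Fin (m + 1) → ℝ) (l : Fin m → ℝ), IsSplit τ θ ∧
    modeRelayPower a σ P τ θ l = γ * P ∧ R = modeRate a b σ P τ θ l}

/-! ### The polynomial satisfied by the gains -/

/-- The polynomial in the gain `X` obtained by eliminating `μ` from the two stationarity equations
(in `μ` and in `X`) of
`(1/2) log (1 + (μ/σ²) (1 + abX)²/(1 + b²X²)) - α μ - β (a² μ + σ²) X²`. -/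
def gainPoly (a b σ α β : ℝ) : ℝ[X] :=
  let A : ℝ[X] := C α + C (β * a ^ 2) * X ^ 2
  let L : ℝ[X] := 1 + C (a * b) * X
  let N : ℝ[X] := 1 + C (b ^ 2) * X ^ 2
  (L ^ 2 - C (2 * σ ^ 2) * A * N) *
      (C b * (C a - C b * X) * A - C (β * a ^ 2) * X * L * N) -
    C (2 * β * σ ^ 2) * A * X * L ^ 3 * N

/-! ### Splitting the band -/

/-- The step function on `[0, 2π)` with value `v j` on the `j`-th of the consecutive subbands of
lengths `2π τ 0, 2π τ 1, …`. -/
def bandStep {m : ℕ} (τ v : Fin m → ℝ) (ω : ℝ) : ℝ :=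
  ∑ j, (Set.Ico (2 * Real.pi * ∑ i ∈ Finset.Iio j, τ i)
    (2 * Real.pi * ∑ i ∈ Finset.Iic j, τ i)).indicator (fun _ => v j) ω

/-- `(1/4π) ∫ log f^d`, where `f^d = 1 + f |1 + abH|² / (σ² (1 + b²|H|²))` is the spectrum of the
whitened destination process for input spectrum `f` and relay frequency response `H`. -/
def spectralRate (a b σ : ℝ) (f H : ℝ → ℝ) : ℝ :=
  1 / (4 * Real.pi) *
    ∫ ω in (0 : ℝ)..(2 * Real.pi), Real.log (1 + f ω / σ ^ 2 * iafFactor a b (H ω))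

/-- Average source power `(1/2π) ∫ f`. -/
def spectralSourcePower (f : ℝ → ℝ) : ℝ :=
  1 / (2 * Real.pi) * ∫ ω in (0 : ℝ)..(2 * Real.pi), f ω

/-- Average relay power `(1/2π) ∫ (a² f + σ²) |H|²`. -/
def spectralRelayPower (a σ : ℝ) (f H : ℝ → ℝ) : ℝ :=
  1 / (2 * Real.pi) * ∫ ω in (0 : ℝ)..(2 * Real.pi), (a ^ 2 * f ω + σ ^ 2) * H ω ^ 2

end LTIRelay

end

noncomputable section

namespace LTIRelay

/-! A mode with input power `μ` and gain modulus `t` has a rate, a source cost and a relay cost,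
hence is a point of `ℝ³`. Time sharing between modes fills the convex hull `rateRegion`. Let `c` be
the largest rate of a point of this hull that meets both power constraints; the claim is that `c` is
the capacity and the finite-letter optimum.

Converse (`blockRate_le_sum`). Let `e i`, `s i` be the eigenvectors and eigenvalues of the input
covariance `S = W Wᴴ`. With noise covariance `N` and channel `G`, Hadamard's inequality for `I +
(GW)ᴴ N⁻¹ (GW)` bounds the rate by a sum of terms in `s i * ⟨G e i, N⁻¹ G e i⟩`. Keeping only the
relay noise forwarded along `H e i` bounds each quadratic form by a function of `‖H e i‖`
(`re_inner_whitened_le`). In the same eigenbasis the trace constraints are averages of mode costs,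
so a block is dominated by `n` modes of weight `1/n`. Gains beyond `|a/b|` amplify noise more than
signal and may be clipped.

Attainment. By Carathéodory in `ℝ³` four modes suffice, and they range over a compact set on which
the rate is continuous. A fifth mode without input power can burn leftover relay power in
arbitrarily little bandwidth, which gives the supremum under an exact relay constraint.

Achievability (`exists_admissible_tendsto`). Real Toeplitz matrices diagonal on a Fourier grid
symmetric about `0` form a commutative family closed under products: circulant for odd `n`,
skew-circulant for even `n`. Rates and powers are therefore exact at each `n`; no Szegő-type limit
is needed, and only the rounding of bandwidths is lost. The same real pairs serve the complex
problem, and for real signals the mutual information equals the log-determinant rate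
(`mutualInformation_jointLaw`).

Gains. Hahn–Banach separation yields multipliers `α, β`, independent of the strategy. By
complementary slackness every mode in use maximizes the Lagrangian, so its gain satisfies two
stationarity equations; eliminating `μ` gives `gainPoly`. If the relay budget allows gain `a/b` at
full power, strict concavity forces every optimal strategy to use only that gain. -/

/-! ### The gain of an aligned relay -/

/-- The factor `iafFactor` of a gain of modulus `t` whose phase is aligned with `ab`. -/
def alignedFactor (a b t : ℝ) : ℝ := (1 + |a * b| * t) ^ 2 / (1 + b ^ 2 * t ^ 2)

/-- The sign of `ab`, with value `1` at `0`. -/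
def gainSign (a b : ℝ) : ℝ := if 0 ≤ a * b then 1 else -1

/-- The real gain of modulus `t` aligned with `ab`. -/
def alignedGain (a b t : ℝ) : ℝ := gainSign a b * t

/-- Rate of a mode with input power `μ` and aligned relay gain of modulus `t`. -/
def pointRate (a b σ μ t : ℝ) : ℝ := gaussCap (μ / σ ^ 2 * alignedFactor a b t)

lemma gainSign_sq (a b : ℝ) : gainSign a b ^ 2 = 1 := by
  unfold gainSign; split_ifs <;> norm_num

lemma mul_gainSign (a b : ℝ) : a * b * gainSign a b = |a * b| := by
  unfold gainSign; split_ifs with h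
  · rw [abs_of_nonneg h, mul_one]
  · rw [abs_of_neg (not_le.mp h)]; ring

lemma alignedGain_sq (a b t : ℝ) : alignedGain a b t ^ 2 = t ^ 2 := by
  rw [alignedGain, mul_pow, gainSign_sq, one_mul]

lemma mul_alignedGain (a b t : ℝ) : a * b * alignedGain a b t = |a * b| * t := by
  rw [alignedGain, ← mul_assoc, mul_gainSign]

lemma iafFactor_real (a b l : ℝ) :
    iafFactor a b l = (1 + a * b * l) ^ 2 / (1 + b ^ 2 * l ^ 2) := by
  simp [iafFactor]

lemma iafFactor_alignedGain (a b t : ℝ) :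
    iafFactor a b (alignedGain a b t) = alignedFactor a b t := by
  rw [iafFactor_real, alignedGain_sq, mul_alignedGain, alignedFactor]

lemma iafFactor_nonneg {𝕜 : Type*} [RCLike 𝕜] (a b : ℝ) (l : 𝕜) : 0 ≤ iafFactor a b l := by
  unfold iafFactor; positivity

lemma alignedFactor_nonneg (a b t : ℝ) : 0 ≤ alignedFactor a b t := by
  unfold alignedFactor; positivity

lemma alignedFactor_pos {a b t : ℝ} (ht : 0 ≤ t) : 0 < alignedFactor a b t := by
  unfold alignedFactor; positivity

lemma alignedFactor_bestGain {a b : ℝ} (hb : b ≠ 0) : alignedFactor a b |a / b| = 1 + a ^ 2 := by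
  have h1 : |a * b| * |a / b| = a ^ 2 := by
    rw [← abs_mul, show a * b * (a / b) = a ^ 2 by field_simp, abs_of_nonneg (sq_nonneg a)]
  have h2 : b ^ 2 * |a / b| ^ 2 = a ^ 2 := by rw [sq_abs]; field_simp
  rw [alignedFactor, h1, h2]
  have : 1 + a ^ 2 ≠ 0 := by positivity
  field_simp

/-- The SNR factor of a relay whose output has correlation `k` with the input, compared with the
best aligned gain of no larger modulus. -/
lemma correlated_le_alignedFactor (a b : ℝ) {t k : ℝ} (ht : 0 ≤ t) (hk1 : k ≤ 1) :
    1 + (2 * |a * b| * t * k + a ^ 2 * b ^ 2 * t ^ 2 - b ^ 2 * t ^ 2 * k ^ 2) / (1 + b ^ 2 * t ^ 2) ≤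
      alignedFactor a b (min t |a / b|) := by
  have hpos : 0 < 1 + b ^ 2 * t ^ 2 := by positivity
  have hab : |a * b| = |a| * |b| := abs_mul a b
  have ha2 : a ^ 2 = |a| ^ 2 := (sq_abs a).symm
  have hb2 : b ^ 2 = |b| ^ 2 := (sq_abs b).symm
  rcases le_total t |a / b| with h | h
  · rw [min_eq_left h, alignedFactor, ← sub_nonneg]
    have hle : |b| * t ≤ |a| := by
      rcases eq_or_ne b 0 with rfl | hb
      · simp
      · rw [abs_div, le_div_iff₀ (abs_pos.mpr hb)] at h; linarith
    -- The difference factors; the last factor is nonnegative because `|b| t ≤ |a|` and `1 + k ≤ 2`.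
    have : (1 + |a * b| * t) ^ 2 / (1 + b ^ 2 * t ^ 2) - (1 + (2 * |a * b| * t * k + a ^ 2 * b ^ 2 * t ^ 2
        - b ^ 2 * t ^ 2 * k ^ 2) / (1 + b ^ 2 * t ^ 2)) =
        (|b| * t) * (1 - k) * (2 * |a| - (|b| * t) * (1 + k)) / (1 + b ^ 2 * t ^ 2) := by
      rw [hab, ha2]
      field_simp
      rw [hb2]; ring
    rw [this]
    have hbt : 0 ≤ |b| * t := by positivity
    have h3 : 0 ≤ 2 * |a| - (|b| * t) * (1 + k) := by nlinarith
    have h4 : 0 ≤ 1 - k := by linarith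
    positivity
  · rw [min_eq_right h]
    rcases eq_or_ne b 0 with rfl | hb
    · simp [alignedFactor]
    · rw [alignedFactor_bestGain hb]
      -- After clearing the denominator the deficit is the square `(|a| - |b| t k)²`.
      have : (2 * |a * b| * t * k + a ^ 2 * b ^ 2 * t ^ 2 - b ^ 2 * t ^ 2 * k ^ 2) / (1 + b ^ 2 * t ^ 2)
          ≤ a ^ 2 := by
        rw [div_le_iff₀ hpos, hab, ha2, hb2]
        nlinarith [sq_nonneg (|a| - |b| * t * k)]
      linarith

lemma alignedFactor_le_clipped (a b : ℝ) {t : ℝ} (ht : 0 ≤ t) :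
    alignedFactor a b t ≤ alignedFactor a b (min t |a / b|) := by
  refine le_trans (le_of_eq ?_) (correlated_le_alignedFactor a b ht le_rfl)
  have hpos : 1 + b ^ 2 * t ^ 2 ≠ 0 := by positivity
  rw [alignedFactor]
  field_simp
  have : |a * b| ^ 2 = a ^ 2 * b ^ 2 := by rw [sq_abs]; ring
  linear_combination t ^ 2 * this

/-- Cauchy–Schwarz for `(1, |a|)` and `(1, |b| t)`, with equality at `t = |a / b|`. For `b = 0` the
factor is constantly `1`. -/
lemma alignedFactor_le_best (a b t : ℝ) :
    alignedFactor a b t ≤ alignedFactor a b |a / b| := by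
  rcases eq_or_ne b 0 with rfl | hb
  · simp [alignedFactor]
  · rw [alignedFactor_bestGain hb, alignedFactor, div_le_iff₀ (by positivity), abs_mul,
      ← sq_abs a, ← sq_abs b]
    nlinarith [sq_nonneg (|a| - |b| * t)]

lemma iafFactor_le_alignedFactor {𝕜 : Type*} [RCLike 𝕜] (a b : ℝ) (l : 𝕜) :
    iafFactor a b l ≤ alignedFactor a b ‖l‖ := by
  unfold iafFactor alignedFactor
  gcongr
  refine (norm_add_le _ _).trans ?_
  simp [norm_mul, abs_mul]

lemma iafFactor_le_clipped {𝕜 : Type*} [RCLike 𝕜] (a b : ℝ) (l : 𝕜) :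
    iafFactor a b l ≤ alignedFactor a b (min ‖l‖ |a / b|) :=
  (iafFactor_le_alignedFactor a b l).trans (alignedFactor_le_clipped a b (norm_nonneg l))

lemma eq_of_iafFactor_eq {a b l : ℝ} (hb : b ≠ 0) (h : iafFactor a b l = 1 + a ^ 2) :
    l = a / b := by
  rw [iafFactor_real, div_eq_iff (by positivity)] at h
  have : (b * l - a) ^ 2 = 0 := by linear_combination -h
  rw [eq_div_iff hb]
  have := pow_eq_zero_iff (two_ne_zero) |>.mp this
  linarith

/-! ### Elementary bounds on the Gaussian rate function -/

lemma gaussCap_mono {x y : ℝ} (hx : 0 ≤ x) (hxy : x ≤ y) : gaussCap x ≤ gaussCap y := by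
  unfold gaussCap
  have : Real.log (1 + x) ≤ Real.log (1 + y) := Real.log_le_log (by linarith) (by linarith)
  linarith

lemma gaussCap_nonneg {x : ℝ} (hx : 0 ≤ x) : 0 ≤ gaussCap x := by
  unfold gaussCap
  have : 0 ≤ Real.log (1 + x) := Real.log_nonneg (by linarith)
  linarith

lemma gaussCap_zero : gaussCap 0 = 0 := by simp [gaussCap]

/-- Sublinear growth is what makes `w * gaussCap (m / w)` vanish as `w` tends to `0`. -/
lemma gaussCap_le_sqrt {x : ℝ} (hx : 0 ≤ x) : gaussCap x ≤ √x := by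
  unfold gaussCap
  have h1 : Real.log (1 + x) = 2 * Real.log (√(1 + x)) := by
    rw [Real.log_sqrt (by linarith)]; ring
  have h2 : Real.log (√(1 + x)) ≤ √(1 + x) - 1 :=
    Real.log_le_sub_one_of_pos (Real.sqrt_pos.mpr (by linarith))
  have h3 : √(1 + x) ≤ 1 + √x := by
    rw [Real.sqrt_le_left (by positivity)]
    nlinarith [Real.sq_sqrt hx, Real.sqrt_nonneg x]
  linarith

lemma pointRate_mono (a b σ : ℝ) {μ t μ' t' : ℝ} (hμ : 0 ≤ μ) (h : μ ≤ μ')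
    (ht : alignedFactor a b t ≤ alignedFactor a b t') : pointRate a b σ μ t ≤ pointRate a b σ μ' t' := by
  unfold pointRate
  have := alignedFactor_nonneg a b t
  have := hμ.trans h
  refine gaussCap_mono (by positivity) ?_
  gcongr

lemma gaussCap_iafFactor_le_pointRate {𝕜 : Type*} [RCLike 𝕜] (a b σ : ℝ) {μ : ℝ} (hμ : 0 ≤ μ) (l : 𝕜) :
    gaussCap (μ / σ ^ 2 * iafFactor a b l) ≤ pointRate a b σ μ (min ‖l‖ |a / b|) := by
  unfold pointRate
  have := iafFactor_nonneg a b l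
  refine gaussCap_mono (by positivity) ?_
  gcongr
  exact iafFactor_le_clipped a b l

/-! ### The optimization over finitely many modes -/

/-- Rate, input power and relay power of one mode. -/
def modePoint (a b σ : ℝ) (x : ℝ × ℝ) : ℝ × ℝ × ℝ :=
  (pointRate a b σ x.1 x.2, x.1, (a ^ 2 * x.1 + σ ^ 2) * x.2 ^ 2)

/-- Time-sharing region of the modes with gain at most `|a / b|`. -/
def rateRegion (a b σ : ℝ) : Set (ℝ × ℝ × ℝ) :=
  convexHull ℝ (modePoint a b σ '' {x | 0 ≤ x.1 ∧ 0 ≤ x.2 ∧ x.2 ≤ |a / b|})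

/-- Four-mode strategies `(w, m, t)`: bandwidth fractions, input powers `m j` spent in the modes, and
moduli of the gains. -/
def fourModes (a b σ P γ : ℝ) : Set ((Fin 4 → ℝ) × (Fin 4 → ℝ) × (Fin 4 → ℝ)) :=
  {x | (∀ j, 0 ≤ x.1 j) ∧ ∑ j, x.1 j = 1 ∧ (∀ j, 0 ≤ x.2.1 j) ∧ ∑ j, x.2.1 j ≤ P ∧
    (∀ j, 0 ≤ x.2.2 j) ∧ (∀ j, x.2.2 j ≤ |a / b|) ∧
    ∑ j, x.2.2 j ^ 2 * (a ^ 2 * x.2.1 j + σ ^ 2 * x.1 j) ≤ γ * P}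

/-- Rate of a four-mode strategy. -/
def fourRate (a b σ : ℝ) (x : (Fin 4 → ℝ) × (Fin 4 → ℝ) × (Fin 4 → ℝ)) : ℝ :=
  ∑ j, x.1 j * pointRate a b σ (x.2.1 j / x.1 j) (x.2.2 j)

lemma isCompact_fourModes (a b σ P γ : ℝ) : IsCompact (fourModes a b σ P γ) := by
  refine (isCompact_Icc (a := ((0, 0, 0) : (Fin 4 → ℝ) × (Fin 4 → ℝ) × (Fin 4 → ℝ)))
    (b := (fun _ => 1, fun _ => P, fun _ => |a / b|))).of_isClosed_subset ?_ ?_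
  · simp only [fourModes, Set.ofPred_and, Set.ofPred_forall]
    refine IsClosed.inter (isClosed_iInter fun j => isClosed_le (by fun_prop) (by fun_prop)) <|
      IsClosed.inter (isClosed_eq (by fun_prop) (by fun_prop)) <|
      IsClosed.inter (isClosed_iInter fun j => isClosed_le (by fun_prop) (by fun_prop)) <|
      IsClosed.inter (isClosed_le (by fun_prop) (by fun_prop)) <|
      IsClosed.inter (isClosed_iInter fun j => isClosed_le (by fun_prop) (by fun_prop)) <|
      IsClosed.inter (isClosed_iInter fun j => isClosed_le (by fun_prop) (by fun_prop)) <|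
      isClosed_le (by fun_prop) (by fun_prop)
  · rintro ⟨w, m, t⟩ ⟨h1, h2, h3, h4, h5, h6, -⟩
    refine ⟨⟨h1, h3, h5⟩, fun j => ?_, fun j => ?_, h6⟩
    · exact (Finset.single_le_sum (fun i _ => h1 i) (Finset.mem_univ j)).trans h2.le
    · exact (Finset.single_le_sum (fun i _ => h3 i) (Finset.mem_univ j)).trans h4

lemma continuous_alignedFactor (a b : ℝ) : Continuous (alignedFactor a b) := by
  unfold alignedFactor
  exact Continuous.div (by fun_prop) (by fun_prop) fun t => by positivity

/-- The perspective of the rate function is continuous up to the boundary. -/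
lemma continuousOn_perspective (a b σ : ℝ) :
    ContinuousOn (fun x : ℝ × ℝ × ℝ => x.1 * pointRate a b σ (x.2.1 / x.1) x.2.2)
      {x | 0 ≤ x.1 ∧ 0 ≤ x.2.1} := by
  rintro ⟨w, m, t⟩ ⟨hw, hm⟩
  dsimp only at hw hm
  have hF := continuous_alignedFactor a b
  rcases hw.eq_or_lt with rfl | hw
  -- At zero bandwidth the value is `0`, and nearby it is squeezed by the square root of a quantity
  -- proportional to the bandwidth.
  · rw [ContinuousWithinAt]
    simp only [zero_mul]
    have hlim : Tendsto (fun x : ℝ × ℝ × ℝ => √(x.1 * (x.2.1 / σ ^ 2 * alignedFactor a b x.2.2)))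
        (𝓝[{x | 0 ≤ x.1 ∧ 0 ≤ x.2.1}] (0, m, t)) (𝓝 0) := by
      have : Continuous fun x : ℝ × ℝ × ℝ => √(x.1 * (x.2.1 / σ ^ 2 * alignedFactor a b x.2.2)) := by
        fun_prop
      have h := this.tendsto (0, m, t)
      simp only [zero_mul, Real.sqrt_zero] at h
      exact h.mono_left nhdsWithin_le_nhds
    refine squeeze_zero' ?_ ?_ hlim
    · filter_upwards [self_mem_nhdsWithin] with x hx
      have := alignedFactor_nonneg a b x.2.2
      have h1 := hx.1
      have h2 := hx.2
      exact mul_nonneg h1 (gaussCap_nonneg (by positivity))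
    · filter_upwards [self_mem_nhdsWithin] with x hx
      have h3 := alignedFactor_nonneg a b x.2.2
      have h1 := hx.1
      have h2 := hx.2
      rcases h1.eq_or_lt with h0 | h0
      · rw [← h0]; simp
      · refine (mul_le_mul_of_nonneg_left (gaussCap_le_sqrt (by positivity)) h1).trans_eq ?_
        rw [← Real.sqrt_sq h1, ← Real.sqrt_mul (sq_nonneg _), Real.sqrt_sq h1]
        congr 1
        field_simp
  · refine ContinuousAt.continuousWithinAt ?_
    unfold pointRate gaussCap
    have hpos : (0 : ℝ) < 1 + m / w / σ ^ 2 * alignedFactor a b t := by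
      have := alignedFactor_nonneg a b t
      positivity
    refine ContinuousAt.mul (by fun_prop) (ContinuousAt.mul (by fun_prop) (ContinuousAt.log ?_ hpos.ne'))
    refine ContinuousAt.add (by fun_prop) (ContinuousAt.mul (ContinuousAt.div_const ?_ _) (by fun_prop))
    exact ContinuousAt.div (by fun_prop) (by fun_prop) hw.ne'

lemma continuousOn_fourRate (a b σ P γ : ℝ) :
    ContinuousOn (fourRate a b σ) (fourModes a b σ P γ) := by
  unfold fourRate
  refine continuousOn_finsetSum _ fun j _ => ?_
  exact (continuousOn_perspective a b σ).comp
    (f := fun x : (Fin 4 → ℝ) × (Fin 4 → ℝ) × (Fin 4 → ℝ) => (x.1 j, x.2.1 j, x.2.2 j))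
    (by fun_prop) (fun x hx => ⟨hx.1 j, hx.2.2.1 j⟩)

lemma exists_isMaxOn_fourRate (a b σ : ℝ) {P γ : ℝ} (hP : 0 < P) (hγ : 0 < γ) :
    ∃ x ∈ fourModes a b σ P γ, ∀ y ∈ fourModes a b σ P γ, fourRate a b σ y ≤ fourRate a b σ x := by
  refine (isCompact_fourModes a b σ P γ).exists_isMaxOn
    ⟨(fun _ => 1 / 4, 0, 0), ?_⟩ (continuousOn_fourRate a b σ P γ)
  refine ⟨fun j => by norm_num, by simp, fun j => le_rfl, by simp [hP.le], fun j => le_rfl,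
    fun j => abs_nonneg _, ?_⟩
  simp; positivity

/-- Carathéodory's theorem for the rate region, in terms of four-mode strategies. -/
lemma exists_fourModes_of_mem_rateRegion {a b σ P γ : ℝ} {k : ℝ × ℝ × ℝ}
    (hk : k ∈ rateRegion a b σ) (hp : k.2.1 ≤ P) (hq : k.2.2 ≤ γ * P) :
    ∃ x ∈ fourModes a b σ P γ, fourRate a b σ x = k.1 := by
  obtain ⟨ι, _, z, w, hz, hind, hw, hw1, hwz⟩ := eq_pos_convex_span_of_mem_convexHull hk
  -- Affinely independent points of `ℝ³` number at most four; unused slots will be padded with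
  -- zeros.
  have hcard : Fintype.card ι ≤ Fintype.card (Fin 4) := by
    simpa using hind.card_le_finrank_succ.trans
      (Nat.succ_le_succ (Submodule.finrank_le _))
  obtain ⟨e⟩ := Function.Embedding.nonempty_of_card_le hcard
  choose y hy hyz using fun i => hz (Set.mem_range_self i)
  have hext : ∀ (f : ι → ℝ) (i), Function.extend e f 0 (e i) = f i := fun f i =>
    e.injective.extend_apply _ _ _
  have hout : ∀ (f : ι → ℝ) (j), j ∉ Set.range e → Function.extend e f 0 j = 0 := fun f j hj => by
    rw [Function.extend_apply' _ _ _ (by simpa using hj)]; rfl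
  have hall : ∀ (f : ι → ℝ) (p : ℝ → Prop), p 0 → (∀ i, p (f i)) → ∀ j, p (Function.extend e f 0 j) := by
    intro f p h0 hf j
    by_cases hj : j ∈ Set.range e
    · obtain ⟨i, rfl⟩ := hj; rw [hext]; exact hf i
    · rw [hout f j hj]; exact h0
  have hsum : ∑ i, w i • modePoint a b σ (y i) = k := by rw [← hwz]; simp [hyz]
  have h1 : ∑ i, w i * pointRate a b σ (y i).1 (y i).2 = k.1 := by
    rw [← hsum]; simp [Prod.fst_sum, modePoint]
  have h2 : ∑ i, w i * (y i).1 = k.2.1 := by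
    rw [← hsum]; simp [Prod.fst_sum, Prod.snd_sum, modePoint]
  have h3 : ∑ i, w i * ((a ^ 2 * (y i).1 + σ ^ 2) * (y i).2 ^ 2) = k.2.2 := by
    rw [← hsum]; simp [Prod.snd_sum, modePoint]
  refine ⟨(Function.extend e w 0, Function.extend e (fun i => w i * (y i).1) 0,
    Function.extend e (fun i => (y i).2) 0), ⟨?_, ?_, ?_, ?_, ?_, ?_, ?_⟩, ?_⟩
  · exact hall _ _ le_rfl fun i => (hw i).le
  · rw [← hw1]
    exact (Fintype.sum_of_injective e e.injective _ _ (fun j hj => hout _ _ hj)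
      fun i => (hext _ i).symm).symm
  · exact hall _ _ le_rfl fun i => mul_nonneg (hw i).le (hy i).1
  · refine le_trans (le_of_eq ?_) hp
    rw [← h2]
    dsimp only
    exact (Fintype.sum_of_injective e e.injective _ _ (fun j hj => hout _ _ hj)
      fun i => (hext _ i).symm).symm
  · exact hall _ _ le_rfl fun i => (hy i).2.1
  · exact hall _ (fun r => r ≤ |a / b|) (abs_nonneg _) fun i => (hy i).2.2
  · refine le_trans (le_of_eq ?_) hq
    rw [← h3]
    refine (Fintype.sum_of_injective e e.injective _ _ (fun j hj => ?_) fun i => ?_).symm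
    · simp only [hout _ _ hj]; simp
    · simp only [hext]; ring
  · rw [← h1]
    refine (Fintype.sum_of_injective e e.injective _ _ (fun j hj => ?_) fun i => ?_).symm
    · simp only [hout _ _ hj]; simp
    · simp only [hext]; rw [mul_div_cancel_left₀ _ (hw i).ne']

/-! ### Rate bounds and Lagrange multipliers -/

/-- `c` bounds the rate of every point of the region that meets both power constraints. -/
def IsRateBound (a b σ P γ c : ℝ) : Prop :=
  ∀ k ∈ rateRegion a b σ, k.2.1 ≤ P → k.2.2 ≤ γ * P → k.1 ≤ c

/-- Every finite family of modes is dominated by a point of the rate region. -/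
lemma IsRateBound.sum_le {a b σ P γ c : ℝ} (hc : IsRateBound a b σ P γ c) {ι : Type*} [Fintype ι]
    {w μ t : ι → ℝ} (hw : ∀ i, 0 ≤ w i) (hw1 : ∑ i, w i = 1) (hμ : ∀ i, 0 ≤ μ i) (ht : ∀ i, 0 ≤ t i)
    (hp : ∑ i, w i * μ i ≤ P) (hq : ∑ i, w i * ((a ^ 2 * μ i + σ ^ 2) * t i ^ 2) ≤ γ * P) :
    ∑ i, w i * pointRate a b σ (μ i) (min (t i) |a / b|) ≤ c := by
  have hmem : ∑ i, w i • modePoint a b σ (μ i, min (t i) |a / b|) ∈ rateRegion a b σ :=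
    (convex_convexHull ℝ _).sum_mem (fun i _ => hw i) hw1 fun i _ => subset_convexHull ℝ _
      ⟨_, ⟨hμ i, le_min (ht i) (abs_nonneg _), min_le_right _ _⟩, rfl⟩
  refine le_trans (le_of_eq ?_) (hc _ hmem ?_ ?_)
  · simp [Prod.fst_sum, modePoint]
  · refine le_trans (le_of_eq ?_) hp
    simp [Prod.fst_sum, Prod.snd_sum, modePoint]
  · refine le_trans (le_of_eq ?_) (le_trans (Finset.sum_le_sum fun i _ =>
      (?_ : w i * ((a ^ 2 * μ i + σ ^ 2) * (min (t i) |a / b|) ^ 2) ≤ _)) hq)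
    · simp [Prod.snd_sum, modePoint]
    · have h1 := hw i
      have h2 := hμ i
      have h3 : 0 ≤ min (t i) |a / b| := le_min (ht i) (abs_nonneg _)
      gcongr
      exact min_le_left _ _

open scoped Pointwise in
/-- Lagrange multipliers of the two power constraints. -/
lemma IsRateBound.exists_multipliers {a b σ P γ c : ℝ} (hc : IsRateBound a b σ P γ c)
    (hP : 0 < P) (hγ : 0 < γ) :
    ∃ α β : ℝ, 0 ≤ α ∧ 0 ≤ β ∧ ∀ μ t : ℝ, 0 ≤ μ → 0 ≤ t → t ≤ |a / b| →
      pointRate a b σ μ t - α * μ - β * ((a ^ 2 * μ + σ ^ 2) * t ^ 2) ≤ c - α * P - β * (γ * P) := by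
  -- The directions of strict worsening: less rate, more of both costs. Adding this open cone makes
  -- the region open and keeps the target point outside.
  set O : Set (ℝ × ℝ × ℝ) := Set.Iio 0 ×ˢ (Set.Ioi 0 ×ˢ Set.Ioi 0) with hO
  have hOo : IsOpen O := isOpen_Iio.prod (isOpen_Ioi.prod isOpen_Ioi)
  have hOc : Convex ℝ O := (convex_Iio 0).prod ((convex_Ioi 0).prod (convex_Ioi 0))
  have hγP : 0 < γ * P := by positivity
  have hnot : (c, P, γ * P) ∉ rateRegion a b σ + O := by
    rintro ⟨k, hk, o, ⟨ho1, ho2, ho3⟩, hko⟩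
    simp only [Set.mem_Iio, Set.mem_Ioi] at ho1 ho2 ho3
    have e1 : k.1 + o.1 = c := congrArg Prod.fst hko
    have e2 : k.2.1 + o.2.1 = P := congrArg (fun z => z.2.1) hko
    have e3 : k.2.2 + o.2.2 = γ * P := congrArg (fun z => z.2.2) hko
    have := hc k hk (by linarith) (by linarith)
    linarith
  obtain ⟨f, hf⟩ := geometric_hahn_banach_open_point ((convex_convexHull ℝ _).add hOc)
    hOo.add_left hnot
  set κ := f (1, 0, 0) with hκ
  set x := f (0, 1, 0) with hx
  set y := f (0, 0, 1) with hy
  have hfe : ∀ r p q : ℝ, f (r, p, q) = r * κ + p * x + q * y := by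
    intro r p q
    have : ((r, p, q) : ℝ × ℝ × ℝ) = r • (1, 0, 0) + p • (0, 1, 0) + q • (0, 0, 1) := by
      ext <;> simp
    rw [this, map_add, map_add, map_smul, map_smul, map_smul]; rfl
  have hineq : ∀ μ t u v s : ℝ, 0 ≤ μ → 0 ≤ t → t ≤ |a / b| → 0 < u → 0 < v → 0 < s →
      (pointRate a b σ μ t - s) * κ + (μ + u) * x + ((a ^ 2 * μ + σ ^ 2) * t ^ 2 + v) * y <
        c * κ + P * x + γ * P * y := by
    intro μ t u v s hμ ht ht' hu hv hs
    have hm : modePoint a b σ (μ, t) ∈ rateRegion a b σ :=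
      subset_convexHull ℝ _ ⟨(μ, t), ⟨hμ, ht, ht'⟩, rfl⟩
    have := hf _ (Set.add_mem_add hm (b := (-s, u, v)) ⟨by simpa using hs, hu, hv⟩)
    simpa only [modePoint, Prod.mk_add_mk, hfe, ← sub_eq_add_neg] using this
  -- The idle mode puts the origin in the region; letting one coordinate run off to infinity then
  -- fixes the sign of each coefficient.
  have hz : ∀ u v s : ℝ, 0 < u → 0 < v → 0 < s →
      -s * κ + u * x + v * y < c * κ + P * x + γ * P * y := by
    intro u v s hu hv hs
    have := hineq 0 0 u v s le_rfl le_rfl (abs_nonneg _) hu hv hs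
    simpa [pointRate, gaussCap_zero] using this
  set B := c * κ + P * x + γ * P * y with hB
  have neg_of_unbounded : ∀ d e : ℝ, (∀ u : ℝ, 0 < u → u * d + e < B) → d ≤ 0 := by
    intro d e h
    by_contra! hd
    have h1 := h ((|B - e| + 1) / d) (by positivity)
    rw [div_mul_cancel₀ _ hd.ne'] at h1
    linarith [le_abs_self (B - e)]
  have hx0 : x ≤ 0 := neg_of_unbounded x (-1 * κ + 1 * y) fun u hu => by
    have := hz u 1 1 hu one_pos one_pos; linarith
  have hy0 : y ≤ 0 := neg_of_unbounded y (-1 * κ + 1 * x) fun u hu => by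
    have := hz 1 u 1 one_pos hu one_pos; linarith
  have hκ0 : 0 ≤ κ := by
    have := neg_of_unbounded (-κ) (1 * x + 1 * y) fun u hu => by
      have := hz 1 1 u one_pos one_pos hu; linarith
    linarith
  -- Slater's condition: the idle mode leaves strict slack in both constraints, so the rate
  -- coefficient cannot vanish.
  have hκpos : 0 < κ := by
    refine hκ0.lt_of_ne fun h0 => ?_
    have := hz (P / 2) (γ * P / 2) 1 (by positivity) (by positivity) one_pos
    rw [hB, ← h0] at this
    nlinarith
  refine ⟨-x / κ, -y / κ, div_nonneg (by linarith) hκ0, div_nonneg (by linarith) hκ0,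
    fun μ t hμ ht ht' => ?_⟩
  have hlim : pointRate a b σ μ t * κ + μ * x + ((a ^ 2 * μ + σ ^ 2) * t ^ 2) * y ≤ B := by
    have hcont : Tendsto (fun s : ℝ => (pointRate a b σ μ t - s) * κ + (μ + s) * x +
        ((a ^ 2 * μ + σ ^ 2) * t ^ 2 + s) * y) (𝓝[>] 0)
        (𝓝 ((pointRate a b σ μ t - 0) * κ + (μ + 0) * x +
        ((a ^ 2 * μ + σ ^ 2) * t ^ 2 + 0) * y)) := by
      refine Tendsto.mono_left (Continuous.tendsto ?_ 0) nhdsWithin_le_nhds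
      fun_prop
    have := le_of_tendsto hcont (b := B) (by
      filter_upwards [self_mem_nhdsWithin] with s hs
      exact (hineq μ t s s s hμ ht ht' hs hs hs).le)
    simpa using this
  rw [← mul_le_mul_iff_left₀ hκpos]
  have e1 : (pointRate a b σ μ t - -x / κ * μ - -y / κ * ((a ^ 2 * μ + σ ^ 2) * t ^ 2)) * κ =
      pointRate a b σ μ t * κ + μ * x + ((a ^ 2 * μ + σ ^ 2) * t ^ 2) * y := by
    field_simp; ring
  have e2 : (c - -x / κ * P - -y / κ * (γ * P)) * κ = B := by
    rw [hB]; field_simp; ring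
  rw [e1, e2]; exact hlim

/-! ### Strategies with finitely many gains -/

/-- Gain `0` for the direct-only mode puts all modes on the same footing. -/
lemma modeRate_eq_sum {𝕜 : Type*} [RCLike 𝕜] (a b σ P : ℝ) {m : ℕ} (τ θ : Fin (m + 1) → ℝ)
    (l : Fin m → 𝕜) :
    modeRate a b σ P τ θ l =
      ∑ j, τ j * gaussCap (θ j * P / τ j / σ ^ 2 * iafFactor a b ((Fin.cons 0 l : Fin (m + 1) → 𝕜) j)) := by
  rw [modeRate, Fin.sum_univ_succ]
  congr 1
  · simp [iafFactor, div_div]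
  · refine Finset.sum_congr rfl fun j _ => ?_
    rw [Fin.cons_succ, div_mul_div_comm, mul_div_assoc, div_div, mul_div_assoc]

lemma modeRelayPower_eq_sum {𝕜 : Type*} [RCLike 𝕜] (a σ P : ℝ) {m : ℕ} (τ θ : Fin (m + 1) → ℝ)
    (l : Fin m → 𝕜) :
    modeRelayPower a σ P τ θ l =
      ∑ j, τ j * ((a ^ 2 * (θ j * P / τ j) + σ ^ 2) *
        ‖(Fin.cons 0 l : Fin (m + 1) → 𝕜) j‖ ^ 2) := by
  rw [modeRelayPower, Fin.sum_univ_succ]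
  simp only [Fin.cons_zero, norm_zero, Fin.cons_succ]
  rw [zero_pow two_ne_zero, mul_zero, mul_zero, zero_add]
  exact Finset.sum_congr rfl fun j _ => by ring

/-- Only an inequality: power assigned to a mode of zero bandwidth is lost, since division by `0`
gives `0`. -/
lemma IsSplit.sum_power_le {m : ℕ} {τ θ : Fin (m + 1) → ℝ} (h : IsSplit τ θ) {P : ℝ} (hP : 0 < P) :
    ∑ j, τ j * (θ j * P / τ j) ≤ P := by
  calc ∑ j, τ j * (θ j * P / τ j) ≤ ∑ j, θ j * P := by
        refine Finset.sum_le_sum fun j _ => ?_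
        rcases eq_or_ne (τ j) 0 with h0 | h0
        · rw [h0, zero_mul]; exact mul_nonneg (h.theta_nonneg j) hP.le
        · rw [mul_div_cancel₀ _ h0]
    _ = P := by rw [← Finset.sum_mul, h.theta_sum, one_mul]

lemma IsSplit.power_nonneg {m : ℕ} {τ θ : Fin (m + 1) → ℝ} (h : IsSplit τ θ) {P : ℝ} (hP : 0 < P)
    (j : Fin (m + 1)) : 0 ≤ θ j * P / τ j :=
  div_nonneg (mul_nonneg (h.theta_nonneg j) hP.le) (h.tau_nonneg j)

/-- Neither more modes nor complex gains exceed a bound of the rate region. -/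
lemma IsRateBound.modeRate_le {𝕜 : Type*} [RCLike 𝕜] {a b σ P γ c : ℝ}
    (hc : IsRateBound a b σ P γ c) (hP : 0 < P) {m : ℕ} {τ θ : Fin (m + 1) → ℝ} {l : Fin m → 𝕜}
    (h : IsSplit τ θ) (hQ : modeRelayPower a σ P τ θ l ≤ γ * P) : modeRate a b σ P τ θ l ≤ c := by
  rw [modeRelayPower_eq_sum] at hQ
  rw [modeRate_eq_sum]
  refine le_trans (Finset.sum_le_sum fun j _ => ?_) (hc.sum_le h.tau_nonneg h.tau_sum
    (h.power_nonneg hP) (fun j => norm_nonneg ((Fin.cons 0 l : Fin (m + 1) → 𝕜) j))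
    (h.sum_power_le hP) hQ)
  exact mul_le_mul_of_nonneg_left
    (gaussCap_iafFactor_le_pointRate a b σ (h.power_nonneg hP j) _) (h.tau_nonneg j)

/-! ### Multipliers and complementary slackness -/

/-- The Lagrangian of a mode with input power `μ` and real gain `l`. -/
def lagrangian (a b σ α β μ l : ℝ) : ℝ :=
  gaussCap (μ / σ ^ 2 * iafFactor a b l) - α * μ - β * ((a ^ 2 * μ + σ ^ 2) * l ^ 2)

/-- `(α, β)` are multipliers which certify that no strategy has rate above `c`. -/
def IsMultiplier (a b σ P γ c α β : ℝ) : Prop :=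
  ∀ μ l : ℝ, 0 ≤ μ → lagrangian a b σ α β μ l ≤ c - α * P - β * (γ * P)

/-- Aligning and clipping a gain does not lower the rate or raise the relay cost, so the bound on
`[0, |a / b|]` extends to all real gains. The full range is needed to differentiate in the gain. -/
lemma IsRateBound.exists_isMultiplier {a b σ P γ c : ℝ} (hc : IsRateBound a b σ P γ c)
    (hP : 0 < P) (hγ : 0 < γ) :
    ∃ α β : ℝ, 0 ≤ α ∧ 0 ≤ β ∧ IsMultiplier a b σ P γ c α β := by
  obtain ⟨α, β, hα, hβ, h⟩ := hc.exists_multipliers hP hγ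
  refine ⟨α, β, hα, hβ, fun μ l hμ => ?_⟩
  have hmin : 0 ≤ min ‖l‖ |a / b| := le_min (norm_nonneg _) (abs_nonneg _)
  refine le_trans ?_ (h μ (min ‖l‖ |a / b|) hμ hmin (min_le_right _ _))
  have h1 := gaussCap_iafFactor_le_pointRate a b σ hμ l
  have h2 : (min ‖l‖ |a / b|) ^ 2 ≤ l ^ 2 := by
    rw [← sq_abs l]
    exact pow_le_pow_left₀ hmin (min_le_left _ _) 2
  have h3 : β * ((a ^ 2 * μ + σ ^ 2) * (min ‖l‖ |a / b|) ^ 2) ≤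
      β * ((a ^ 2 * μ + σ ^ 2) * l ^ 2) := by gcongr
  unfold lagrangian
  linarith

lemma sum_lagrangian (a b σ P α β : ℝ) {m : ℕ} (τ θ : Fin (m + 1) → ℝ) (l : Fin m → ℝ) :
    ∑ j, τ j * lagrangian a b σ α β (θ j * P / τ j) ((Fin.cons 0 l : Fin (m + 1) → ℝ) j) =
      modeRate a b σ P τ θ l - α * ∑ j, τ j * (θ j * P / τ j) -
        β * modeRelayPower a σ P τ θ l := by
  rw [modeRate_eq_sum, modeRelayPower_eq_sum, Finset.mul_sum, Finset.mul_sum,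
    ← Finset.sum_sub_distrib, ← Finset.sum_sub_distrib]
  refine Finset.sum_congr rfl fun j _ => ?_
  rw [lagrangian, Real.norm_eq_abs, sq_abs]
  ring

section Slackness

variable {a b σ P γ c α β : ℝ} (hM : IsMultiplier a b σ P γ c α β) (hP : 0 < P) (hα : 0 ≤ α)
  (hβ : 0 ≤ β) {m : ℕ} {τ θ : Fin (m + 1) → ℝ} {l : Fin m → ℝ} (h : IsSplit τ θ)
  (hQ : modeRelayPower a σ P τ θ l ≤ γ * P)

-- The weighted defects add up to the rate gap minus the priced relay slack; the unspent source
-- power, priced by `α ≥ 0`, is dropped. As each defect is nonnegative, weak duality and slackness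
-- both follow.
include hP hα h in
lemma sum_defect_le :
    ∑ j, τ j * (c - α * P - β * (γ * P) -
      lagrangian a b σ α β (θ j * P / τ j) ((Fin.cons 0 l : Fin (m + 1) → ℝ) j)) ≤
      c - modeRate a b σ P τ θ l - β * (γ * P - modeRelayPower a σ P τ θ l) := by
  simp only [mul_sub (τ _), Finset.sum_sub_distrib]
  have := mul_le_mul_of_nonneg_left (h.sum_power_le hP) hα
  rw [sum_lagrangian, ← Finset.sum_mul, ← Finset.sum_mul, ← Finset.sum_mul, h.tau_sum]
  linarith

include hM hP h in
lemma IsMultiplier.defect_nonneg (j : Fin (m + 1)) :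
    0 ≤ τ j * (c - α * P - β * (γ * P) -
      lagrangian a b σ α β (θ j * P / τ j) ((Fin.cons 0 l : Fin (m + 1) → ℝ) j)) :=
  mul_nonneg (h.tau_nonneg j) (sub_nonneg.mpr (hM _ _ (h.power_nonneg hP j)))

include hM hP hα hβ h hQ in
lemma IsMultiplier.modeRate_le : modeRate a b σ P τ θ l ≤ c := by
  have h1 := sum_defect_le (a := a) (b := b) (σ := σ) (γ := γ) (c := c) (β := β) hP hα h (l := l)
  have h2 := Finset.sum_nonneg fun j (_ : j ∈ Finset.univ) => hM.defect_nonneg hP h (l := l) j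
  have h3 := mul_nonneg hβ (sub_nonneg.mpr hQ)
  linarith

variable (hR : modeRate a b σ P τ θ l = c)

include hM hP hα h hR in
lemma IsMultiplier.slack_nonpos : β * (γ * P - modeRelayPower a σ P τ θ l) ≤ 0 := by
  have h1 := sum_defect_le (a := a) (b := b) (σ := σ) (γ := γ) (c := c) (β := β) hP hα h (l := l)
  have h2 := Finset.sum_nonneg fun j (_ : j ∈ Finset.univ) => hM.defect_nonneg hP h (l := l) j
  linarith

-- At rate `c` the nonnegative defects have sum at most `0`, so each vanishes.
include hM hP hα hβ h hQ hR in
lemma IsMultiplier.active (j : Fin (m + 1)) (hj : 0 < τ j) :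
    lagrangian a b σ α β (θ j * P / τ j) ((Fin.cons 0 l : Fin (m + 1) → ℝ) j) =
      c - α * P - β * (γ * P) := by
  have h1 := sum_defect_le (a := a) (b := b) (σ := σ) (γ := γ) (c := c) (β := β) hP hα h (l := l)
  have h3 := mul_nonneg hβ (sub_nonneg.mpr hQ)
  have h4 := Finset.single_le_sum (fun j _ => hM.defect_nonneg hP h (l := l) j) (Finset.mem_univ j)
  have h5 := hM.defect_nonneg hP h (l := l) j
  have h6 := mul_eq_zero.mp (le_antisymm (by linarith) h5)
  rcases h6 with h6 | h6
  · exact absurd h6 hj.ne'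
  · linarith

end Slackness

/-! ### The rate without relay power constraint -/

/-- Multiplier of the input power when the relay is unconstrained. -/
def fullMultiplier (a b σ P : ℝ) : ℝ :=
  alignedFactor a b |a / b| / (2 * (σ ^ 2 + P * alignedFactor a b |a / b|))

lemma fullMultiplier_nonneg (a b σ : ℝ) {P : ℝ} (hP : 0 < P) : 0 ≤ fullMultiplier a b σ P := by
  have := alignedFactor_nonneg a b |a / b|
  unfold fullMultiplier
  positivity

/-- A strictly concave function lies below its tangent at `P`: `log r ≤ r - 1` for the ratio `r` of
received powers, strictly unless `r = 1`. -/
lemma gaussCap_tangent {σ P M μ : ℝ} (hσ : 0 < σ) (hP : 0 < P) (hM : 0 < M) (hμ : 0 ≤ μ) :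
    gaussCap (μ / σ ^ 2 * M) - M / (2 * (σ ^ 2 + P * M)) * μ ≤
      gaussCap (P / σ ^ 2 * M) - M / (2 * (σ ^ 2 + P * M)) * P ∧
    (gaussCap (μ / σ ^ 2 * M) - M / (2 * (σ ^ 2 + P * M)) * μ =
      gaussCap (P / σ ^ 2 * M) - M / (2 * (σ ^ 2 + P * M)) * P → μ = P) := by
  have hP' : 0 < σ ^ 2 + P * M := by positivity
  have hμ' : 0 < σ ^ 2 + μ * M := by positivity
  set r := (σ ^ 2 + μ * M) / (σ ^ 2 + P * M) with hr
  have hr0 : 0 < r := by positivity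
  have hlog : gaussCap (μ / σ ^ 2 * M) - gaussCap (P / σ ^ 2 * M) = 1 / 2 * Real.log r := by
    have h1 : 1 + μ / σ ^ 2 * M = (σ ^ 2 + μ * M) / σ ^ 2 := by field_simp
    have h2 : 1 + P / σ ^ 2 * M = (σ ^ 2 + P * M) / σ ^ 2 := by field_simp
    rw [gaussCap, gaussCap, h1, h2, Real.log_div hμ'.ne' (by positivity),
      Real.log_div hP'.ne' (by positivity), hr, Real.log_div hμ'.ne' hP'.ne']
    ring
  have hlin : M / (2 * (σ ^ 2 + P * M)) * μ - M / (2 * (σ ^ 2 + P * M)) * P = 1 / 2 * (r - 1) := by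
    rw [hr]; field_simp; ring
  refine ⟨?_, fun h => ?_⟩
  · have := Real.log_le_sub_one_of_pos hr0
    linarith
  · by_contra hne
    have hr1 : r ≠ 1 := by
      rw [hr, Ne, div_eq_one_iff_eq hP'.ne']
      intro h'
      have : (μ - P) * M = 0 := by linarith
      rcases mul_eq_zero.mp this with h'' | h''
      · exact hne (by linarith)
      · exact hM.ne' h''
    have := Real.log_lt_sub_one_of_pos hr0 hr1
    linarith

lemma isMultiplier_full (a b γ : ℝ) {σ P : ℝ} (hσ : 0 < σ) (hP : 0 < P) :
    IsMultiplier a b σ P γ (pointRate a b σ P |a / b|) (fullMultiplier a b σ P) 0 := by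
  intro μ l hμ
  have hM := alignedFactor_pos (a := a) (b := b) (abs_nonneg (a / b))
  have h1 := (gaussCap_tangent hσ hP hM hμ).1
  have h2 : gaussCap (μ / σ ^ 2 * iafFactor a b l) ≤ gaussCap (μ / σ ^ 2 * alignedFactor a b |a / b|) := by
    have := iafFactor_nonneg a b l
    refine gaussCap_mono (by positivity) ?_
    gcongr
    exact (iafFactor_le_alignedFactor a b l).trans (alignedFactor_le_best _ _ _)
  rw [lagrangian, fullMultiplier, pointRate]
  linarith

/-- A strategy which attains the unconstrained rate uses the power `P` and the gain `a / b` in all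
its modes. -/
lemma eq_of_modeRate_eq_full {a b σ P γ : ℝ} (hb : b ≠ 0) (hσ : 0 < σ) (hP : 0 < P) {m : ℕ}
    {τ θ : Fin (m + 1) → ℝ} {l : Fin m → ℝ} (h : IsSplit τ θ)
    (hQ : modeRelayPower a σ P τ θ l ≤ γ * P)
    (hR : modeRate a b σ P τ θ l = pointRate a b σ P |a / b|) (j : Fin (m + 1)) (hj : 0 < τ j) :
    θ j * P / τ j = P ∧ (Fin.cons 0 l : Fin (m + 1) → ℝ) j = a / b := by
  have hM := alignedFactor_pos (a := a) (b := b) (abs_nonneg (a / b))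
  have hact := (isMultiplier_full a b γ hσ hP).active hP (fullMultiplier_nonneg a b σ hP) le_rfl h hQ
    hR j hj
  set μ := θ j * P / τ j
  set x := (Fin.cons 0 l : Fin (m + 1) → ℝ) j
  have hμ : 0 ≤ μ := h.power_nonneg hP j
  have ht := gaussCap_tangent hσ hP hM hμ
  have hF0 := iafFactor_nonneg a b x
  have hF := (iafFactor_le_alignedFactor a b x).trans (alignedFactor_le_best _ _ _)
  have h2 : gaussCap (μ / σ ^ 2 * iafFactor a b x) ≤ gaussCap (μ / σ ^ 2 * alignedFactor a b |a / b|) :=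
    gaussCap_mono (by positivity) (by gcongr)
  rw [lagrangian, fullMultiplier, pointRate] at hact
  have hμP := ht.2 (le_antisymm ht.1 (by linarith))
  refine ⟨hμP, eq_of_iafFactor_eq hb ?_⟩
  rw [hμP, zero_mul, zero_mul, sub_zero, sub_zero] at hact
  have h3 : gaussCap (P / σ ^ 2 * iafFactor a b x) = gaussCap (P / σ ^ 2 * alignedFactor a b |a / b|) := by
    linarith
  unfold gaussCap at h3
  have h4 := Real.log_injOn_pos (Set.mem_Ioi.mpr (by positivity)) (Set.mem_Ioi.mpr (by positivity))
    (mul_left_cancel₀ (by norm_num) h3)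
  have h5 := mul_left_cancel₀ (by positivity) (add_left_cancel h4)
  rw [h5, alignedFactor_bestGain hb]

/-- All modes in use are identical, which pins down the relay power; this is the threshold
separating the two regimes of the relay budget. -/
lemma modeRelayPower_of_modeRate_eq_full {a b σ P γ : ℝ} (hb : b ≠ 0) (hσ : 0 < σ) (hP : 0 < P) {m : ℕ}
    {τ θ : Fin (m + 1) → ℝ} {l : Fin m → ℝ} (h : IsSplit τ θ)
    (hQ : modeRelayPower a σ P τ θ l ≤ γ * P)
    (hR : modeRate a b σ P τ θ l = pointRate a b σ P |a / b|) :
    b ^ 2 * modeRelayPower a σ P τ θ l = a ^ 2 * (a ^ 2 * P + σ ^ 2) := by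
  have : modeRelayPower a σ P τ θ l = ∑ j, τ j * ((a ^ 2 * P + σ ^ 2) * (a / b) ^ 2) := by
    rw [modeRelayPower_eq_sum]
    refine Finset.sum_congr rfl fun j _ => ?_
    rcases (h.tau_nonneg j).eq_or_lt with h0 | h0
    · rw [← h0, zero_mul, zero_mul]
    · obtain ⟨h1, h2⟩ := eq_of_modeRate_eq_full hb hσ hP h hQ hR j h0
      rw [h1, h2, Real.norm_eq_abs, sq_abs]
  rw [this, ← Finset.sum_mul, h.tau_sum]
  field_simp

/-! ### Four modes as a strategy with seven gains -/

/-- Bandwidth fractions of four modes scaled by `1 - ε`, with a fifth mode of bandwidth `ε`. -/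
def sevenTau (ε : ℝ) (w : Fin 4 → ℝ) : Fin 8 → ℝ :=
  Fin.cons 0 ![(1 - ε) * w 0, (1 - ε) * w 1, (1 - ε) * w 2, (1 - ε) * w 3, ε, 0, 0]

/-- Power fractions of four modes; the rest of the power is assigned to mode `0`. -/
def sevenTheta (P : ℝ) (m : Fin 4 → ℝ) : Fin 8 → ℝ :=
  Fin.cons (1 - (∑ j, m j) / P) ![m 0 / P, m 1 / P, m 2 / P, m 3 / P, 0, 0, 0]

/-- Four aligned gains and one further gain. -/
def sevenGain (a b : ℝ) (t : Fin 4 → ℝ) (x : ℝ) : Fin 7 → ℝ :=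
  ![alignedGain a b (t 0), alignedGain a b (t 1), alignedGain a b (t 2), alignedGain a b (t 3), x, 0, 0]

lemma isSplit_seven {P ε : ℝ} (hP : 0 < P) (hε : 0 ≤ ε) (hε1 : ε ≤ 1) {w m : Fin 4 → ℝ}
    (hw : ∀ j, 0 ≤ w j) (hw1 : ∑ j, w j = 1) (hm : ∀ j, 0 ≤ m j) (hmP : ∑ j, m j ≤ P) :
    IsSplit (sevenTau ε w) (sevenTheta P m) where
  tau_nonneg j := by
    have h0 := mul_nonneg (sub_nonneg.mpr hε1) (hw 0)
    have h1 := mul_nonneg (sub_nonneg.mpr hε1) (hw 1)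
    have h2 := mul_nonneg (sub_nonneg.mpr hε1) (hw 2)
    have h3 := mul_nonneg (sub_nonneg.mpr hε1) (hw 3)
    fin_cases j
    exacts [le_rfl, h0, h1, h2, h3, hε, le_rfl, le_rfl]
  theta_nonneg j := by
    have h (i) := div_nonneg (hm i) hP.le
    have h' : 0 ≤ 1 - (∑ j, m j) / P := sub_nonneg.mpr ((div_le_one hP).mpr hmP)
    fin_cases j
    exacts [h', h 0, h 1, h 2, h 3, le_rfl, le_rfl, le_rfl]
  tau_sum := by
    rw [Fin.sum_univ_four] at hw1
    simp [sevenTau, Fin.sum_univ_succ]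
    linear_combination (1 - ε) * hw1
  theta_sum := by
    simp [sevenTheta, Fin.sum_univ_succ]
    ring

lemma modeRate_seven (a b σ : ℝ) {P : ℝ} (hP : 0 < P) (ε x : ℝ) (w m t : Fin 4 → ℝ) :
    modeRate a b σ P (sevenTau ε w) (sevenTheta P m) (sevenGain a b t x) =
      ∑ j, (1 - ε) * w j * pointRate a b σ (m j / ((1 - ε) * w j)) (t j) := by
  have h (u v z : ℝ) : gaussCap (u / P / v * (P / σ ^ 2) * z) = gaussCap (u / v / σ ^ 2 * z) := by
    congr 2; field_simp
  simp only [modeRate, sevenTau, sevenTheta, sevenGain, Fin.sum_univ_succ, Fin.cons_zero, Fin.cons_succ,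
    pointRate]
  simp [h, iafFactor_alignedGain, gaussCap_zero]

lemma modeRelayPower_seven (a b σ : ℝ) {P : ℝ} (hP : 0 < P) (ε x : ℝ) (w m t : Fin 4 → ℝ) :
    modeRelayPower a σ P (sevenTau ε w) (sevenTheta P m) (sevenGain a b t x) =
      ∑ j, (1 - ε) * w j * t j ^ 2 * (a ^ 2 * m j / ((1 - ε) * w j) + σ ^ 2) + ε * x ^ 2 * σ ^ 2 := by
  have h (u : ℝ) : a ^ 2 * (u / P) * P = a ^ 2 * u := by field_simp
  simp only [modeRelayPower, sevenTau, sevenTheta, sevenGain, Fin.sum_univ_succ, Fin.cons_succ]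
  simp [h, alignedGain_sq]
  ring

/-- Compressing a mode at fixed input power keeps its forwarded signal power and reduces its
forwarded noise; a mode of zero bandwidth spends nothing. -/
lemma modeRelayPower_seven_le (a b σ : ℝ) {P ε : ℝ} (hP : 0 < P) (hε : 0 ≤ ε) (x : ℝ)
    {w m t : Fin 4 → ℝ} (hw : ∀ j, 0 ≤ w j) (hm : ∀ j, 0 ≤ m j) :
    modeRelayPower a σ P (sevenTau ε w) (sevenTheta P m) (sevenGain a b t x) ≤
      ∑ j, t j ^ 2 * (a ^ 2 * m j + σ ^ 2 * w j) + ε * x ^ 2 * σ ^ 2 := by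
  rw [modeRelayPower_seven a b σ hP]
  refine add_le_add (Finset.sum_le_sum fun j _ => ?_) le_rfl
  have h1 := hw j
  have h2 := hm j
  rcases eq_or_ne ((1 - ε) * w j) 0 with h0 | h0
  · rw [h0, zero_mul, zero_mul]; positivity
  · rw [mul_comm _ (t j ^ 2), mul_assoc, mul_add, mul_div_cancel₀ _ h0]
    have : (1 - ε) * w j ≤ w j := by nlinarith
    have : (1 - ε) * w j * σ ^ 2 ≤ σ ^ 2 * w j := by nlinarith [sq_nonneg σ]
    gcongr

/-- Compression raises the power density of each mode, so the rate falls at most in proportion to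
the bandwidth. -/
lemma le_modeRate_seven (a b σ : ℝ) {P ε : ℝ} (hP : 0 < P) (hε : 0 ≤ ε) (hε1 : ε < 1) (x : ℝ)
    {w m t : Fin 4 → ℝ} (hw : ∀ j, 0 ≤ w j) (hm : ∀ j, 0 ≤ m j) :
    (1 - ε) * fourRate a b σ (w, m, t) ≤
      modeRate a b σ P (sevenTau ε w) (sevenTheta P m) (sevenGain a b t x) := by
  rw [modeRate_seven a b σ hP, fourRate, Finset.mul_sum]
  refine Finset.sum_le_sum fun j _ => ?_
  rw [← mul_assoc]
  have h1 := hw j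
  have h2 := hm j
  have h3 : 0 < 1 - ε := by linarith
  refine mul_le_mul_of_nonneg_left (pointRate_mono a b σ (div_nonneg h2 h1) ?_ le_rfl) (by positivity)
  rcases h1.eq_or_lt with h0 | h0
  · dsimp only; rw [← h0]; simp
  · exact div_le_div_of_nonneg_left h2 (by positivity) (by nlinarith)

lemma modeRate_seven_zero (a b σ : ℝ) {P : ℝ} (hP : 0 < P) (x : ℝ) (w m t : Fin 4 → ℝ) :
    modeRate a b σ P (sevenTau 0 w) (sevenTheta P m) (sevenGain a b t x) = fourRate a b σ (w, m, t) := by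
  simp [modeRate_seven a b σ hP, fourRate]

lemma sevenGain_aligned (a b : ℝ) {t : Fin 4 → ℝ} (ht : ∀ j, 0 ≤ t j) (j : Fin 7) :
    0 ≤ a * b * sevenGain a b t 0 j := by
  have h (i) : 0 ≤ a * b * alignedGain a b (t i) := by
    rw [mul_alignedGain]; exact mul_nonneg (abs_nonneg _) (ht i)
  have h' : 0 ≤ a * b * (0 : ℝ) := by simp
  fin_cases j
  exacts [h 0, h 1, h 2, h 3, h', h', h']

/-! ### Stationarity of the gains -/

/-- The two products each have an `X⁸` term, with coefficients that cancel; the coefficient of `X⁷`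
does not vanish. -/
lemma natDegree_gainPoly {a b σ α β : ℝ} (ha : a ≠ 0) (hb : b ≠ 0) (hσ : 0 < σ) (hβ : 0 < β) :
    (gainPoly a b σ α β).natDegree = 7 := by
  have hpoly : ∃ c0 c1 c2 c3 c4 c5 c6 : ℝ, gainPoly a b σ α β =
      C (-2 * σ ^ 2 * (β * a ^ 2) ^ 2 * b ^ 4) * X ^ 7 + C c6 * X ^ 6 + C c5 * X ^ 5 + C c4 * X ^ 4 +
        C c3 * X ^ 3 + C c2 * X ^ 2 + C c1 * X + C c0 := by
    refine ⟨1 * a * b * α + (-2) * a * b * σ ^ 2 * α ^ 2,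
      (-2) * σ ^ 2 * α * β + (-1) * b ^ 2 * α + 2 * b ^ 2 * σ ^ 2 * α ^ 2 + (-1) * a ^ 2 *
      β + 2 * a ^ 2 * σ ^ 2 * α * β + 2 * a ^ 2 * b ^ 2 * α,
      (-6) * a * b * σ ^ 2 * α * β + (-2) * a * b ^ 3 * α + (-2) * a * b ^ 3 * σ ^ 2 * α ^
      2 + (-2) * a ^ 3 * b * β + (-2) * a ^ 3 * b * σ ^ 2 * α * β + 1 * a ^ 3 * b ^ 3 * α,
      (-2) * b ^ 2 * σ ^ 2 * α * β + 2 * b ^ 4 * σ ^ 2 * α ^ 2 + (-2) * a ^ 2 * σ ^ 2 * β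
      ^ 2 + (-2) * a ^ 2 * b ^ 2 * β + 2 * a ^ 2 * b ^ 2 * σ ^ 2 * α * β + (-1) * a ^ 2 *
      b ^ 4 * α + 2 * a ^ 4 * σ ^ 2 * β ^ 2 + (-1) * a ^ 4 * b ^ 2 * β,
      (-6) * a * b ^ 3 * σ ^ 2 * α * β + (-6) * a ^ 3 * b * σ ^ 2 * β ^ 2 + (-5) * a ^ 3 *
      b ^ 3 * β + (-2) * a ^ 3 * b ^ 3 * σ ^ 2 * α * β,
      (-2) * a ^ 2 * b ^ 2 * σ ^ 2 * β ^ 2 + (-4) * a ^ 4 * b ^ 4 * β,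
      (-6) * a ^ 3 * b ^ 3 * σ ^ 2 * β ^ 2 + (-1) * a ^ 5 * b ^ 5 * β, ?_⟩
    unfold gainPoly
    simp only [map_mul, map_pow, map_neg, map_ofNat, map_add, map_one]
    ring
  obtain ⟨c0, c1, c2, c3, c4, c5, c6, h⟩ := hpoly
  rw [h]
  compute_degree!
  exact ⟨⟨hσ.ne', hβ.ne', ha⟩, hb⟩

/-- An interior maximum of the Lagrangian is a root of `gainPoly`. -/
lemma isRoot_gainPoly {a b σ α β μ l κ : ℝ} (ha : a ≠ 0) (hσ : 0 < σ) (hα : 0 ≤ α) (hβ : 0 < β)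
    (hμ : 0 < μ) (hmax : ∀ μ' l' : ℝ, 0 ≤ μ' → lagrangian a b σ α β μ' l' ≤ κ)
    (heq : lagrangian a b σ α β μ l = κ) : (gainPoly a b σ α β).IsRoot l := by
  set L := 1 + a * b * l with hL
  set N := 1 + b ^ 2 * l ^ 2 with hN
  set A := α + β * a ^ 2 * l ^ 2 with hA
  have hN0 : 0 < N := by positivity
  have hD : 0 < 1 + μ / σ ^ 2 * (L ^ 2 / N) := by positivity
  have hD' : 0 < σ ^ 2 * N + μ * L ^ 2 := by positivity
  have hd1 : HasDerivAt (fun μ' => lagrangian a b σ α β μ' l)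
      (1 / 2 * ((1 / σ ^ 2 * (L ^ 2 / N)) / (1 + μ / σ ^ 2 * (L ^ 2 / N))) - α * 1 -
        β * ((a ^ 2 * 1) * l ^ 2)) μ := by
    unfold lagrangian gaussCap
    rw [iafFactor_real]
    have := ((((((hasDerivAt_id μ).div_const (σ ^ 2)).mul_const (L ^ 2 / N)).const_add 1).log
      hD.ne').const_mul (1 / 2)).sub ((hasDerivAt_id μ).const_mul α) |>.sub
      (((((hasDerivAt_id μ).const_mul (a ^ 2)).add_const (σ ^ 2)).mul_const (l ^ 2)).const_mul β)
    exact this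
  have hd2 : HasDerivAt (fun l' => lagrangian a b σ α β μ l')
      (1 / 2 * ((μ / σ ^ 2 * ((2 * L * (a * b) * N - L ^ 2 * (b ^ 2 * (2 * l))) / N ^ 2)) /
        (1 + μ / σ ^ 2 * (L ^ 2 / N))) - β * ((a ^ 2 * μ + σ ^ 2) * (2 * l))) l := by
    unfold lagrangian gaussCap
    simp only [iafFactor_real]
    have hl2 : HasDerivAt (fun l' : ℝ => l' ^ 2) (2 * l) l := by simpa using hasDerivAt_pow 2 l
    have hLd : HasDerivAt (fun l' : ℝ => (1 + a * b * l') ^ 2) (2 * L * (a * b)) l := by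
      have := (((hasDerivAt_id l).const_mul (a * b)).const_add 1).fun_pow 2
      simpa using this
    have hNd : HasDerivAt (fun l' : ℝ => 1 + b ^ 2 * l' ^ 2) (b ^ 2 * (2 * l)) l :=
      (hl2.const_mul (b ^ 2)).const_add 1
    have := (((((hLd.div hNd hN0.ne').const_mul (μ / σ ^ 2)).const_add 1).log hD.ne').const_mul
      (1 / 2)).sub_const (α * μ) |>.sub ((hl2.const_mul (a ^ 2 * μ + σ ^ 2)).const_mul β)
    exact this
  have e1 := IsLocalMax.hasDerivAt_eq_zero (f := fun μ' => lagrangian a b σ α β μ' l) (a := μ) (by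
    filter_upwards [lt_mem_nhds hμ] with μ' hμ'
    rw [heq]; exact hmax μ' l hμ'.le) hd1
  have e2 := IsLocalMax.hasDerivAt_eq_zero (f := fun l' => lagrangian a b σ α β μ l') (a := l) (by
    filter_upwards with l'
    rw [heq]; exact hmax μ l' hμ.le) hd2
  -- Stationarity in `μ` and, in `f2`, in the gain, with denominators cleared.
  have f1 : L ^ 2 = 2 * A * (σ ^ 2 * N + μ * L ^ 2) := by
    have : (1 / σ ^ 2 * (L ^ 2 / N)) / (1 + μ / σ ^ 2 * (L ^ 2 / N)) =
        L ^ 2 / (σ ^ 2 * N + μ * L ^ 2) := by field_simp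
    rw [this] at e1
    have h2 : L ^ 2 / (σ ^ 2 * N + μ * L ^ 2) = 2 * A := by rw [hA]; linarith
    rwa [div_eq_iff hD'.ne'] at h2
  have f2 : μ * L * b * (a - b * l) = 2 * β * (a ^ 2 * μ + σ ^ 2) * l * N * (σ ^ 2 * N + μ * L ^ 2) := by
    have : (μ / σ ^ 2 * ((2 * L * (a * b) * N - L ^ 2 * (b ^ 2 * (2 * l))) / N ^ 2)) /
        (1 + μ / σ ^ 2 * (L ^ 2 / N)) =
        μ * (2 * L * (a * b) * N - L ^ 2 * (b ^ 2 * (2 * l))) / (N * (σ ^ 2 * N + μ * L ^ 2)) := by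
      field_simp
    rw [this] at e2
    have h2 : μ * (2 * L * (a * b) * N - L ^ 2 * (b ^ 2 * (2 * l))) / (N * (σ ^ 2 * N + μ * L ^ 2)) =
        2 * (β * ((a ^ 2 * μ + σ ^ 2) * (2 * l))) := by linarith
    rw [div_eq_iff (by positivity)] at h2
    have h3 : 2 * L * (a * b) * N - L ^ 2 * (b ^ 2 * (2 * l)) = 2 * L * b * (a - b * l) := by
      rw [hN, hL]; ring
    rw [h3] at h2
    linear_combination h2 / 2
  -- If `L = 0`, then `f1` forces `A = 0`, hence `l = 0`, where `L = 1`.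
  have hL0 : L ≠ 0 := by
    intro h0
    rw [h0] at f1
    have hA0 : A = 0 := by
      have : 0 < σ ^ 2 * N := by positivity
      have h' : A * (σ ^ 2 * N) = 0 := by linarith
      exact (mul_eq_zero.mp h').resolve_right this.ne'
    have hl : l = 0 := by
      by_contra hl
      have : 0 < A := by positivity
      exact this.ne' hA0
    rw [hL, hl] at h0
    simp at h0
  -- Elimination of `μ`: by `f1`, `2Aμ L² = L² - 2σ²AN`, which is substituted in `f2`. A spare
  -- factor `L` remains and is cancelled.
  have hroot : L * ((L ^ 2 - 2 * σ ^ 2 * A * N) * (b * (a - b * l) * A - β * a ^ 2 * l * L * N) -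
      2 * β * σ ^ 2 * A * l * L ^ 3 * N) = 0 := by
    linear_combination (L * (b * (a - b * l) * A - β * a ^ 2 * l * L * N) -
      2 * A * L ^ 2 * β * l * N * (a ^ 2 * μ + σ ^ 2)) * f1 + 2 * A ^ 2 * L ^ 2 * f2
  have := (mul_eq_zero.mp hroot).resolve_left hL0
  simp only [gainPoly, IsRoot.def, eval_sub, eval_mul, eval_pow, eval_add, eval_one, eval_C, eval_X]
  exact this

/-! ### Step functions on the band -/

/-- The `j`-th of the consecutive subbands of lengths `2π τ 0, 2π τ 1, …`. -/
def subband {m : ℕ} (τ : Fin m → ℝ) (j : Fin m) : Set ℝ :=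
  Set.Ico (2 * Real.pi * ∑ i ∈ Finset.Iio j, τ i) (2 * Real.pi * ∑ i ∈ Finset.Iic j, τ i)

lemma eq_of_mem_subband {m : ℕ} {τ : Fin m → ℝ} (hτ : ∀ j, 0 ≤ τ j) {i j : Fin m} {ω : ℝ}
    (hi : ω ∈ subband τ i) (hj : ω ∈ subband τ j) : i = j := by
  have key : ∀ i j : Fin m, i < j → ω ∈ subband τ i → ω ∈ subband τ j → False := by
    intro i j hij hi hj
    have h1 : ∑ k ∈ Finset.Iic i, τ k ≤ ∑ k ∈ Finset.Iio j, τ k :=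
      Finset.sum_le_sum_of_subset_of_nonneg
        (fun k hk => Finset.mem_Iio.mpr ((Finset.mem_Iic.mp hk).trans_lt hij)) fun k _ _ => hτ k
    have h2 := mul_le_mul_of_nonneg_left h1 Real.two_pi_pos.le
    exact absurd (hi.2.trans_le (h2.trans hj.1)) (lt_irrefl _)
  rcases lt_trichotomy i j with h | h | h
  · exact (key i j h hi hj).elim
  · exact h
  · exact (key j i h hj hi).elim

lemma bandStep_of_mem {m : ℕ} {τ : Fin m → ℝ} (hτ : ∀ j, 0 ≤ τ j) (v : Fin m → ℝ) {j : Fin m} {ω : ℝ}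
    (hj : ω ∈ subband τ j) : bandStep τ v ω = v j := by
  unfold bandStep
  rw [Finset.sum_eq_single j]
  · exact Set.indicator_of_mem hj _
  · intro i _ hij
    exact Set.indicator_of_notMem (fun hi => hij (eq_of_mem_subband hτ hi hj)) _
  · simp

lemma bandStep_of_forall_notMem {m : ℕ} {τ : Fin m → ℝ} (v : Fin m → ℝ) {ω : ℝ}
    (h : ∀ j, ω ∉ subband τ j) : bandStep τ v ω = 0 :=
  Finset.sum_eq_zero fun j _ => Set.indicator_of_notMem (h j) _

lemma integral_bandStep {m : ℕ} {τ : Fin m → ℝ} (hτ : ∀ j, 0 ≤ τ j) (hτ1 : ∑ j, τ j = 1)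
    (v : Fin m → ℝ) :
    ∫ ω in (0 : ℝ)..(2 * Real.pi), bandStep τ v ω = 2 * Real.pi * ∑ j, τ j * v j := by
  rw [intervalIntegral.integral_of_le Real.two_pi_pos.le, ← integral_Ico_eq_integral_Ioc]
  unfold bandStep
  rw [integral_finsetSum _ fun j _ => ?_, Finset.mul_sum]
  · refine Finset.sum_congr rfl fun j _ => ?_
    have hsub : subband τ j ⊆ Set.Ico 0 (2 * Real.pi) := by
      refine Set.Ico_subset_Ico ?_ ?_
      · exact mul_nonneg Real.two_pi_pos.le (Finset.sum_nonneg fun i _ => hτ i)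
      · refine mul_le_of_le_one_right Real.two_pi_pos.le ?_
        rw [← hτ1]
        exact Finset.sum_le_sum_of_subset_of_nonneg (Finset.subset_univ _) fun i _ _ => hτ i
    have hlen : ∑ i ∈ Finset.Iic j, τ i = ∑ i ∈ Finset.Iio j, τ i + τ j := by
      rw [← Finset.Iio_insert j, Finset.sum_insert (by simp), add_comm]
    rw [subband] at hsub
    rw [setIntegral_indicator measurableSet_Ico, Set.inter_eq_right.mpr hsub, setIntegral_const,
      measureReal_def, Real.volume_Ico, hlen, ENNReal.toReal_ofReal, smul_eq_mul]
    · ring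
    · have := mul_nonneg Real.two_pi_pos.le (hτ j)
      linarith
  · exact (integrable_const (v j)).indicator measurableSet_Ico

/-- The condition on `g 0 0` settles frequencies in no subband, so that the subbands need not be
shown to cover the band. -/
lemma integral_comp_bandStep {m : ℕ} {τ : Fin m → ℝ} (hτ : ∀ j, 0 ≤ τ j) (hτ1 : ∑ j, τ j = 1)
    (u v : Fin m → ℝ) (g : ℝ → ℝ → ℝ) (hg : g 0 0 = 0) :
    ∫ ω in (0 : ℝ)..(2 * Real.pi), g (bandStep τ u ω) (bandStep τ v ω) =
      2 * Real.pi * ∑ j, τ j * g (u j) (v j) := by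
  rw [← integral_bandStep hτ hτ1]
  congr 1
  ext ω
  by_cases h : ∃ j, ω ∈ subband τ j
  · obtain ⟨j, hj⟩ := h
    rw [bandStep_of_mem hτ u hj, bandStep_of_mem hτ v hj, bandStep_of_mem hτ _ hj]
  · push Not at h
    rw [bandStep_of_forall_notMem u h, bandStep_of_forall_notMem v h, bandStep_of_forall_notMem _ h, hg]

section Band

variable {m : ℕ} {τ θ : Fin (m + 1) → ℝ} (h : IsSplit τ θ) (a b σ P : ℝ) (l : Fin m → ℝ)

include h in
lemma spectralSourcePower_bandStep (hP : 0 < P) :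
    spectralSourcePower (bandStep τ fun j => θ j * P / τ j) ≤ P := by
  rw [spectralSourcePower, integral_bandStep h.tau_nonneg h.tau_sum]
  refine le_trans (le_of_eq ?_) (h.sum_power_le hP)
  rw [← mul_assoc, one_div_mul_cancel Real.two_pi_pos.ne', one_mul]

include h in
lemma spectralRelayPower_bandStep :
    spectralRelayPower a σ (bandStep τ fun j => θ j * P / τ j) (bandStep τ (Fin.cons 0 l)) =
      modeRelayPower a σ P τ θ l := by
  rw [spectralRelayPower, integral_comp_bandStep h.tau_nonneg h.tau_sum _ _
    (fun x y => (a ^ 2 * x + σ ^ 2) * y ^ 2) (by simp), modeRelayPower_eq_sum]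
  have := Real.pi_ne_zero
  rw [← mul_assoc, one_div_mul_cancel (by positivity), one_mul]
  simp only [Real.norm_eq_abs, sq_abs]

include h in
lemma spectralRate_bandStep :
    spectralRate a b σ (bandStep τ fun j => θ j * P / τ j) (bandStep τ (Fin.cons 0 l)) =
      modeRate a b σ P τ θ l := by
  rw [spectralRate, integral_comp_bandStep h.tau_nonneg h.tau_sum _ _
    (fun x y => Real.log (1 + x / σ ^ 2 * iafFactor a b y)) (by simp), modeRate_eq_sum]
  have := Real.pi_ne_zero
  rw [← mul_assoc, show 1 / (4 * Real.pi) * (2 * Real.pi) = 1 / 2 by field_simp; norm_num,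
    Finset.mul_sum]
  refine Finset.sum_congr rfl fun j _ => ?_
  rw [gaussCap]
  ring

end Band

/-! ### The finite-letter formula -/

/-- The finite-letter part of the capacity theorem. -/
theorem exists_finiteLetter (a b : ℝ) {σ P γ : ℝ} (hσ : 0 < σ) (hP : 0 < P) (hγ : 0 < γ) :
    ∃ c : ℝ, IsRateBound a b σ P γ c ∧
      (∃ x ∈ fourModes a b σ P γ, fourRate a b σ x = c) ∧
      IsGreatest (modeRates a b σ P γ 7) c ∧ IsLUB (modeRatesEq a b σ P γ 7) c ∧
      (b ^ 2 * (γ * P) ≤ a ^ 2 * (a ^ 2 * P + σ ^ 2) → IsGreatest (modeRatesEq a b σ P γ 7) c) ∧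
      (b ≠ 0 → ∃ p : ℝ[X], p.natDegree = 7 ∧
        (b ^ 2 * (γ * P) < a ^ 2 * (a ^ 2 * P + σ ^ 2) →
          ∃ α β : ℝ, 0 ≤ α ∧ 0 < β ∧ p = gainPoly a b σ α β) ∧
        ∀ (m : ℕ) (τ θ : Fin (m + 1) → ℝ) (l : Fin m → ℝ), IsSplit τ θ →
          modeRelayPower a σ P τ θ l ≤ γ * P → modeRate a b σ P τ θ l = c →
          ∀ j : Fin m, 0 < τ j.succ → 0 < θ j.succ → p.IsRoot (l j)) := by
  obtain ⟨⟨w, m, t⟩, hx, hmax⟩ := exists_isMaxOn_fourRate a b σ hP hγ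
  obtain ⟨c, hcx⟩ : ∃ c, fourRate a b σ (w, m, t) = c := ⟨_, rfl⟩
  have hγP : 0 < γ * P := by positivity
  have hc : IsRateBound a b σ P γ c := by
    intro k hk hp hq
    obtain ⟨y, hy, hyk⟩ := exists_fourModes_of_mem_rateRegion hk hp hq
    rw [← hyk, ← hcx]; exact hmax y hy
  have hx' := hx
  obtain ⟨hw, hw1, hm, hmP, ht, -, hq⟩ := hx'
  dsimp only at hw hw1 hm hmP ht hq
  have hsplit (ε : ℝ) (h0 : 0 ≤ ε) (h1 : ε ≤ 1) : IsSplit (sevenTau ε w) (sevenTheta P m) :=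
    isSplit_seven hP h0 h1 hw hw1 hm hmP
  have hQ0 (ε : ℝ) (h0 : 0 ≤ ε) :
      modeRelayPower a σ P (sevenTau ε w) (sevenTheta P m) (sevenGain a b t 0) ≤ γ * P :=
    (modeRelayPower_seven_le a b σ hP h0 0 hw hm).trans (by simpa using hq)
  have hR0 : modeRate a b σ P (sevenTau 0 w) (sevenTheta P m) (sevenGain a b t 0) = c := by
    rw [modeRate_seven_zero a b σ hP, hcx]
  have hub : c ∈ upperBounds (modeRatesEq a b σ P γ 7) := by
    rintro _ ⟨τ, θ, l, hs, hQ, rfl⟩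
    exact hc.modeRate_le hP hs hQ.le
  have hfull_le : c ≤ pointRate a b σ P |a / b| := by
    rw [← hR0]
    exact (isMultiplier_full a b γ hσ hP).modeRate_le hP (fullMultiplier_nonneg a b σ hP) le_rfl
      (hsplit 0 le_rfl zero_le_one) (hQ0 0 le_rfl)
  obtain ⟨α, β, hα, hβ, hM⟩ := hc.exists_isMultiplier hP hγ
  -- With a free relay constraint the multiplier inequality, tested at power `P` and gain modulus
  -- `|a / b|`, gives the reverse bound.
  have hle_full_of_beta (hβ0 : β = 0) : c = pointRate a b σ P |a / b| := by
    refine le_antisymm hfull_le ?_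
    have := hM P (alignedGain a b |a / b|) hP.le
    rw [lagrangian, iafFactor_alignedGain, hβ0] at this
    rw [pointRate]; linarith
  -- All bandwidth and all power in one mode of gain `x`.
  have hsingle : ∀ x : ℝ, ∃ (τ θ : Fin 8 → ℝ) (l : Fin 7 → ℝ), IsSplit τ θ ∧
        modeRelayPower a σ P τ θ l = (a ^ 2 * P + σ ^ 2) * x ^ 2 ∧
        modeRate a b σ P τ θ l = gaussCap (P / σ ^ 2 * iafFactor a b x) := by
    intro x
    refine ⟨Fin.cons 0 (Fin.cons 1 0), Fin.cons 0 (Fin.cons 1 0), fun _ => x, ⟨?_, ?_, ?_, ?_⟩, ?_, ?_⟩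
    · intro j
      refine Fin.cases (by simp) (fun j => Fin.cases (by simp) (fun j => by simp) j) j
    · intro j
      refine Fin.cases (by simp) (fun j => Fin.cases (by simp) (fun j => by simp) j) j
    · simp [Fin.sum_univ_succ]
    · simp [Fin.sum_univ_succ]
    · simp [modeRelayPower, Fin.sum_univ_succ]; ring
    · simp [modeRate, Fin.sum_univ_succ]
  refine ⟨c, hc, ⟨_, hx, hcx⟩, ⟨⟨_, _, _, hsplit 0 le_rfl zero_le_one, hQ0 0 le_rfl, hR0.symm⟩, ?_⟩,
    ⟨hub, ?_⟩, fun hcond => ⟨?_, hub⟩, fun hb => ?_⟩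
  · rintro _ ⟨τ, θ, l, hs, hQ, rfl⟩
    exact hc.modeRate_le hP hs hQ
  · intro d hd
    have hbound : ∀ ε : ℝ, ε ∈ Set.Ioo (0 : ℝ) 1 → (1 - ε) * c ≤ d := by
      intro ε ⟨h0, h1⟩
      set Q := modeRelayPower a σ P (sevenTau ε w) (sevenTheta P m) (sevenGain a b t 0) with hQdef
      have hQ := hQ0 ε h0.le
      -- Chosen so that the empty mode, which forwards noise only, spends exactly the slack: `ε x²
      -- σ² = γP - Q`.
      set x := √((γ * P - Q) / (ε * σ ^ 2)) with hxdef
      have hx2 : x ^ 2 = (γ * P - Q) / (ε * σ ^ 2) :=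
        Real.sq_sqrt (div_nonneg (by linarith) (by positivity))
      rw [← hcx]
      refine (le_modeRate_seven a b σ hP h0.le h1 x hw hm (t := t)).trans
        (hd ⟨_, _, _, hsplit ε h0.le h1.le, ?_, rfl⟩)
      rw [modeRelayPower_seven a b σ hP] at hQdef ⊢
      rw [hx2]
      have : ε * ((γ * P - Q) / (ε * σ ^ 2)) * σ ^ 2 = γ * P - Q := by field_simp
      rw [this]
      simp only [ne_eq, OfNat.ofNat_ne_zero, not_false_eq_true, zero_pow, mul_zero, zero_mul,
        add_zero] at hQdef
      linarith
    have hlim : Tendsto (fun ε : ℝ => (1 - ε) * c) (𝓝[>] 0) (𝓝 ((1 - 0) * c)) :=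
      Tendsto.mono_left (Continuous.tendsto (by fun_prop) 0) nhdsWithin_le_nhds
    rw [sub_zero, one_mul] at hlim
    exact le_of_tendsto hlim (by filter_upwards [Ioo_mem_nhdsGT one_pos] with ε hε using hbound ε hε)
  · rcases eq_or_ne b 0 with rfl | hb
    -- For `b = 0` the rate ignores the gain, so a single gain may be tuned to spend the whole
    -- budget.
    · have hpos : 0 < a ^ 2 * P + σ ^ 2 := by positivity
      have hx2 : (a ^ 2 * P + σ ^ 2) * √(γ * P / (a ^ 2 * P + σ ^ 2)) ^ 2 = γ * P := by
        rw [Real.sq_sqrt (by positivity)]; field_simp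
      obtain ⟨τ, θ, l, hs, hQ, hR⟩ := hsingle √(γ * P / (a ^ 2 * P + σ ^ 2))
      refine ⟨τ, θ, l, hs, hQ.trans hx2, ?_⟩
      refine le_antisymm ?_ (hc.modeRate_le hP hs (hQ.trans hx2).le)
      rw [hR]
      simpa [pointRate, alignedFactor, iafFactor_real] using hfull_le
    · refine ⟨_, _, _, hsplit 0 le_rfl zero_le_one, ?_, hR0.symm⟩
      refine le_antisymm (hQ0 0 le_rfl) ?_
      -- Slack would force `β = 0`, hence the unconstrained rate, whose relay power is at least the
      -- budget in this regime.
      by_contra! hlt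
      have h1 := hM.slack_nonpos hP hα (hsplit 0 le_rfl zero_le_one) hR0
      have hβ0 : β = 0 := le_antisymm (nonpos_of_mul_nonpos_left h1 (by linarith)) hβ
      have h2 := modeRelayPower_of_modeRate_eq_full hb hσ hP (hsplit 0 le_rfl zero_le_one)
        (hQ0 0 le_rfl) (hR0.trans (hle_full_of_beta hβ0))
      have h3 : 0 < b ^ 2 := by positivity
      nlinarith
  · rcases lt_or_ge (b ^ 2 * (γ * P)) (a ^ 2 * (a ^ 2 * P + σ ^ 2)) with hcond | hcond
    · have ha : a ≠ 0 := by
        rintro rfl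
        have : 0 ≤ b ^ 2 * (γ * P) := by positivity
        simp at hcond
        linarith
      have hβpos : 0 < β := by
        refine hβ.lt_of_ne fun h0 => ?_
        have h2 := modeRelayPower_of_modeRate_eq_full hb hσ hP (hsplit 0 le_rfl zero_le_one)
          (hQ0 0 le_rfl) (hR0.trans (hle_full_of_beta h0.symm))
        have h3 := mul_le_mul_of_nonneg_left (hQ0 0 le_rfl) (sq_nonneg b)
        linarith
      refine ⟨gainPoly a b σ α β, natDegree_gainPoly ha hb hσ hβpos, fun _ => ⟨α, β, hα, hβpos, rfl⟩,
        fun m τ θ l hs hQ hR j hj hj' => ?_⟩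
      have hact := hM.active hP hα hβ hs hQ hR j.succ hj
      rw [Fin.cons_succ] at hact
      exact isRoot_gainPoly ha hσ hα hβpos (by positivity) hM hact
    · have hcf : c = pointRate a b σ P |a / b| := by
        refine le_antisymm hfull_le ?_
        have hx2 : (a ^ 2 * P + σ ^ 2) * alignedGain a b |a / b| ^ 2 ≤ γ * P := by
          rw [alignedGain_sq, sq_abs, div_pow, ← mul_div_assoc, div_le_iff₀ (by positivity)]
          linarith
        obtain ⟨τ, θ, l, hs, hQ, hR⟩ := hsingle (alignedGain a b |a / b|)
        rw [iafFactor_alignedGain] at hR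
        rw [pointRate, ← hR]
        exact hc.modeRate_le hP hs (hQ.trans_le hx2)
      -- Every gain in use is `a / b`, so any polynomial of degree seven with this root would do.
      refine ⟨(X - C (a / b)) ^ 7, by simp, fun h => absurd h (not_lt.mpr hcond),
        fun m τ θ l hs hQ hR j hj _ => ?_⟩
      have := (eq_of_modeRate_eq_full hb hσ hP hs hQ (hR.trans hcf) j.succ hj).2
      rw [Fin.cons_succ] at this
      simp [this]

/-! ### Upper bound on the rate of a block -/

/-- Hadamard's inequality. -/
lemma re_det_le_prod_diag {𝕜 : Type*} [RCLike 𝕜] {n : ℕ} {M : Matrix (Fin n) (Fin n) 𝕜}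
    (hM : M.PosDef) : RCLike.re M.det ≤ ∏ i, RCLike.re (M i i) := by
  have hd : ∀ i, 0 < RCLike.re (M i i) := fun i => (RCLike.pos_iff.mp hM.diag_pos).1
  have hdi : ∀ i, ((RCLike.re (M i i) : ℝ) : 𝕜) = M i i := fun i => hM.isHermitian.coe_re_apply_self i
  -- Rescaling to unit diagonal makes the trace `n`; then `x ≤ exp (x - 1)` shows that the product
  -- of the eigenvalues is at most `1`.
  set r : Fin n → ℝ := fun i => (√(RCLike.re (M i i)))⁻¹ with hr
  have hr0 : ∀ i, 0 < r i := fun i => inv_pos.mpr (Real.sqrt_pos.mpr (hd i))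
  have hr2 : ∀ i, r i ^ 2 * RCLike.re (M i i) = 1 := fun i => by
    rw [hr]; simp only [inv_pow, Real.sq_sqrt (hd i).le]; exact inv_mul_cancel₀ (hd i).ne'
  set D : Matrix (Fin n) (Fin n) 𝕜 := Matrix.diagonal fun i => ((r i : ℝ) : 𝕜) with hD
  have hDH : Dᴴ = D := by
    rw [hD, Matrix.diagonal_conjTranspose]; congr 1; ext i; simp
  have hDdet : D.det = ((∏ i, r i : ℝ) : 𝕜) := by rw [hD, Matrix.det_diagonal]; simp
  have hDunit : IsUnit D := by
    rw [Matrix.isUnit_iff_isUnit_det, hDdet, isUnit_iff_ne_zero, RCLike.ofReal_ne_zero]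
    exact (Finset.prod_pos fun i _ => hr0 i).ne'
  have hX : (Dᴴ * M * D).PosDef :=
    hM.conjTranspose_mul_mul_same (Matrix.mulVec_injective_of_isUnit hDunit)
  rw [hDH] at hX
  have htr : (D * M * D).trace = n := by
    rw [Matrix.trace]
    simp only [Matrix.diag_apply, hD, Matrix.mul_diagonal, Matrix.diagonal_mul]
    rw [Finset.sum_congr rfl (g := fun _ => (1 : 𝕜))]
    · simp
    · intro i _
      rw [← hdi i]
      have := congrArg (fun x : ℝ => (x : 𝕜)) (hr2 i)
      simp only [RCLike.ofReal_mul, RCLike.ofReal_pow, RCLike.ofReal_one] at this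
      rw [← this]; ring
  have hsum : ∑ i, hX.isHermitian.eigenvalues i = n := by
    have := hX.isHermitian.trace_eq_sum_eigenvalues
    rw [htr] at this
    exact_mod_cast this.symm
  have hdet1 : ∏ i, hX.isHermitian.eigenvalues i ≤ 1 := by
    calc ∏ i, hX.isHermitian.eigenvalues i
        ≤ ∏ i, Real.exp (hX.isHermitian.eigenvalues i - 1) := by
          refine Finset.prod_le_prod (fun i _ => (hX.eigenvalues_pos i).le) fun i _ => ?_
          have := Real.add_one_le_exp (hX.isHermitian.eigenvalues i - 1)
          linarith
      _ = 1 := by rw [← Real.exp_sum, Finset.sum_sub_distrib, hsum]; simp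
  have hdet2 : ((∏ i, hX.isHermitian.eigenvalues i : ℝ) : 𝕜) = ((∏ i, r i) ^ 2 : ℝ) * M.det := by
    have := hX.isHermitian.det_eq_prod_eigenvalues
    rw [Matrix.det_mul, Matrix.det_mul, hDdet] at this
    push_cast at this ⊢
    rw [← this]; ring
  have hdet3 : (∏ i, r i) ^ 2 * RCLike.re M.det ≤ 1 := by
    have := congrArg RCLike.re hdet2
    rw [RCLike.re_ofReal_mul, RCLike.ofReal_re] at this
    linarith
  have hprod : (∏ i, r i) ^ 2 * ∏ i, RCLike.re (M i i) = 1 := by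
    rw [← Finset.prod_pow, ← Finset.prod_mul_distrib]; simp [hr2]
  have hpos : 0 < (∏ i, r i) ^ 2 := pow_pos (Finset.prod_pos fun i _ => hr0 i) 2
  exact le_of_mul_le_mul_left (by rw [hprod]; exact hdet3) hpos

/-- The SNR of a unit input direction `e`: the relay noise in the direction of `T e` cannot be
avoided. -/
lemma re_inner_whitened_le {𝕜 E : Type*} [RCLike 𝕜] [NormedAddCommGroup E] [InnerProductSpace 𝕜 E]
    [CompleteSpace E] (a b : ℝ) {σ : ℝ} (hσ : 0 < σ) (T : E →L[𝕜] E) {e z : E} (he : ‖e‖ = 1)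
    (hz : ((σ ^ 2 : ℝ) : 𝕜) • (z + ((b ^ 2 : ℝ) : 𝕜) • T (ContinuousLinearMap.adjoint T z)) =
      e + ((a * b : ℝ) : 𝕜) • T e) :
    RCLike.re (inner 𝕜 (e + ((a * b : ℝ) : 𝕜) • T e) z) ≤
      alignedFactor a b (min ‖T e‖ |a / b|) / σ ^ 2 := by
  set g := T e with hg
  set v := e + ((a * b : ℝ) : 𝕜) • g with hv
  set t := ‖g‖ with ht
  set d := 1 + b ^ 2 * t ^ 2 with hd
  have hd0 : 0 < d := by positivity
  set p := inner 𝕜 g z with hp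
  -- Sherman–Morrison: `u` is `v` multiplied by the inverse of `1 + b² g gᴴ`, the noise covariance
  -- reduced to the direction of `g`.
  set ν : 𝕜 := inner 𝕜 g v / (d : 𝕜) with hν
  set u := v - (((b ^ 2 : ℝ) : 𝕜) * ν) • g with hu
  -- Noise reduction: `⟨T e, z⟩ = ⟨e, T* z⟩` has modulus at most `‖T* z‖` because `e` is a unit
  -- vector.
  have hlow : σ ^ 2 * (‖z‖ ^ 2 + b ^ 2 * ‖p‖ ^ 2) ≤ RCLike.re (inner 𝕜 v z) := by
    have h1 : RCLike.re (inner 𝕜 v z) =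
        σ ^ 2 * (‖z‖ ^ 2 + b ^ 2 * ‖ContinuousLinearMap.adjoint T z‖ ^ 2) := by
      rw [← hz, inner_smul_left, inner_add_left, inner_smul_left, RCLike.conj_ofReal,
        RCLike.conj_ofReal, ← ContinuousLinearMap.adjoint_inner_right, RCLike.re_ofReal_mul, map_add,
        RCLike.re_ofReal_mul, inner_self_eq_norm_sq, inner_self_eq_norm_sq]
    have h2 : ‖p‖ ≤ ‖ContinuousLinearMap.adjoint T z‖ := by
      rw [hp, hg, ← ContinuousLinearMap.adjoint_inner_right]
      exact (norm_inner_le_norm _ _).trans_eq (by rw [he, one_mul])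
    rw [h1]
    gcongr
  have hsplit : RCLike.re (inner 𝕜 v z) =
      RCLike.re (inner 𝕜 u z) + b ^ 2 * RCLike.re ((starRingEnd 𝕜) ν * p) := by
    have : v = u + (((b ^ 2 : ℝ) : 𝕜) * ν) • g := by rw [hu]; abel
    rw [this, inner_add_left, inner_smul_left, map_add, RingHom.map_mul, RCLike.conj_ofReal, mul_assoc,
      RCLike.re_ofReal_mul]
  have hσ2 : 0 < σ ^ 2 := by positivity
  have hamgm : ∀ x y : ℝ, 2 * (x * y) ≤ x ^ 2 / σ ^ 2 + σ ^ 2 * y ^ 2 := by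
    intro x y
    have : x ^ 2 / σ ^ 2 + σ ^ 2 * y ^ 2 - 2 * (x * y) = (x / σ - σ * y) ^ 2 := by
      field_simp; ring
    nlinarith [sq_nonneg (x / σ - σ * y)]
  have h1 : 2 * RCLike.re (inner 𝕜 u z) ≤ ‖u‖ ^ 2 / σ ^ 2 + σ ^ 2 * ‖z‖ ^ 2 :=
    le_trans (by linarith [re_inner_le_norm (𝕜 := 𝕜) u z]) (hamgm ‖u‖ ‖z‖)
  have h2 : 2 * RCLike.re ((starRingEnd 𝕜) ν * p) ≤ ‖ν‖ ^ 2 / σ ^ 2 + σ ^ 2 * ‖p‖ ^ 2 := by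
    refine le_trans ?_ (hamgm ‖ν‖ ‖p‖)
    have := RCLike.re_le_norm ((starRingEnd 𝕜) ν * p)
    rw [norm_mul, RCLike.norm_conj] at this
    linarith
  -- The two Young inequalities bound twice the left side; `hlow` absorbs their `z` and `p` terms
  -- into one copy of it.
  have hup : RCLike.re (inner 𝕜 v z) ≤ (‖u‖ ^ 2 + b ^ 2 * ‖ν‖ ^ 2) / σ ^ 2 := by
    have h3 := mul_le_mul_of_nonneg_left h2 (sq_nonneg b)
    have h4 : (‖u‖ ^ 2 + b ^ 2 * ‖ν‖ ^ 2) / σ ^ 2 = ‖u‖ ^ 2 / σ ^ 2 + b ^ 2 * (‖ν‖ ^ 2 / σ ^ 2) := by ring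
    rw [h4]; linarith
  refine hup.trans (div_le_div_of_nonneg_right ?_ hσ2.le)
  set q := inner 𝕜 g e with hq
  have hgv : inner 𝕜 g v = q + ((a * b * t ^ 2 : ℝ) : 𝕜) := by
    rw [hv, inner_add_right, inner_smul_right, inner_self_eq_norm_sq_to_K, hq, ht]
    push_cast; ring
  have hgvn : ‖inner 𝕜 g v‖ ^ 2 = ‖q‖ ^ 2 + 2 * (a * b * t ^ 2) * RCLike.re q + (a * b * t ^ 2) ^ 2 := by
    rw [hgv, ← RCLike.normSq_eq_def', RCLike.normSq_add, RCLike.normSq_eq_def', RCLike.normSq_eq_def',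
      RCLike.conj_ofReal, mul_comm q, RCLike.re_ofReal_mul, RCLike.norm_ofReal, sq_abs]
    ring
  have hvn : ‖v‖ ^ 2 = 1 + 2 * (a * b) * RCLike.re q + (a * b) ^ 2 * t ^ 2 := by
    rw [hv, @norm_add_sq 𝕜, inner_smul_right, RCLike.re_ofReal_mul, he, norm_smul, RCLike.norm_ofReal,
      mul_pow, sq_abs, ← inner_conj_symm, RCLike.conj_re]
    ring
  have hνn : ‖ν‖ = ‖inner 𝕜 g v‖ / d := by
    rw [hν, norm_div, RCLike.norm_ofReal, abs_of_pos hd0]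
  have hun : ‖u‖ ^ 2 = ‖v‖ ^ 2 - 2 * b ^ 2 * (‖inner 𝕜 g v‖ ^ 2 / d) + b ^ 4 * ‖ν‖ ^ 2 * t ^ 2 := by
    have hre : RCLike.re (inner 𝕜 v ((((b ^ 2 : ℝ) : 𝕜) * ν) • g)) = b ^ 2 * (‖inner 𝕜 g v‖ ^ 2 / d) := by
      rw [inner_smul_right, mul_assoc, RCLike.re_ofReal_mul, hν, div_mul_eq_mul_div,
        ← inner_conj_symm v g, RCLike.mul_conj, ← RCLike.ofReal_pow, ← RCLike.ofReal_div,
        RCLike.ofReal_re]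
    rw [hu, @norm_sub_sq 𝕜, hre, norm_smul, norm_mul, RCLike.norm_ofReal, abs_of_nonneg (sq_nonneg b)]
    ring
  have hqt : ‖q‖ ≤ t := (norm_inner_le_norm _ _).trans_eq (by rw [he, mul_one])
  have ht0 : 0 ≤ t := norm_nonneg _
  -- Modulus of the correlation between the input direction and its relayed image; it is `0` when `t
  -- = 0`.
  set k := ‖q‖ / t with hk
  have hk1 : k ≤ 1 := div_le_one_of_le₀ hqt ht0
  have hqk : ‖q‖ = t * k := by
    rcases eq_or_ne t 0 with h0 | h0
    · rw [h0, zero_mul]; exact le_antisymm (hqt.trans_eq h0) (norm_nonneg _)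
    · rw [hk, mul_div_cancel₀ _ h0]
  have hval : ‖u‖ ^ 2 + b ^ 2 * ‖ν‖ ^ 2 =
      1 + (2 * (a * b * RCLike.re q) + a ^ 2 * b ^ 2 * t ^ 2 - b ^ 2 * ‖q‖ ^ 2) / d := by
    rw [hun, hvn, hνn, div_pow, hgvn]
    field_simp
    rw [hd]; ring
  rw [hval]
  refine le_trans ?_ (correlated_le_alignedFactor a b ht0 hk1)
  have habq : a * b * RCLike.re q ≤ |a * b| * (t * k) := by
    rw [← hqk]
    refine (le_abs_self _).trans ?_
    rw [abs_mul]
    gcongr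
    exact RCLike.abs_re_le_norm q
  have : 2 * (a * b * RCLike.re q) + a ^ 2 * b ^ 2 * t ^ 2 - b ^ 2 * ‖q‖ ^ 2 ≤
      2 * |a * b| * t * k + a ^ 2 * b ^ 2 * t ^ 2 - b ^ 2 * t ^ 2 * k ^ 2 := by
    rw [hqk]; nlinarith
  gcongr

lemma posDef_noiseCov {𝕜 : Type*} [RCLike 𝕜] (b : ℝ) {σ : ℝ} (hσ : 0 < σ) {n : ℕ}
    (H : Matrix (Fin n) (Fin n) 𝕜) : (noiseCov b σ H).PosDef := by
  unfold noiseCov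
  refine Matrix.PosDef.smul (Matrix.PosDef.one.add_posSemidef
    ((Matrix.posSemidef_self_mul_conjTranspose H).smul ?_)) ?_
  · exact RCLike.ofReal_nonneg.mpr (sq_nonneg b)
  · exact RCLike.ofReal_pos.mpr (by positivity)

lemma conjTranspose_mul_mul_diag {𝕜 : Type*} [RCLike 𝕜] {n : ℕ} (A B : Matrix (Fin n) (Fin n) 𝕜)
    (i : Fin n) : (Bᴴ * A * B) i i = star (fun k => B k i) ⬝ᵥ (A *ᵥ fun k => B k i) := by
  rw [mul_assoc, Matrix.mul_apply]
  rfl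

/-- The rate of a block in terms of the eigenvalues of the input covariance. -/
lemma blockRate_le_sum {𝕜 : Type*} [RCLike 𝕜] (a b : ℝ) {σ : ℝ} (hσ : 0 < σ) {n : ℕ}
    {S : Matrix (Fin n) (Fin n) 𝕜} (hS : S.PosSemidef) (H : Matrix (Fin n) (Fin n) 𝕜) :
    blockRate a b σ S H ≤ 1 / n * ∑ i, pointRate a b σ (hS.isHermitian.eigenvalues i)
      (min ‖Matrix.toEuclideanCLM (𝕜 := 𝕜) H (hS.isHermitian.eigenvectorBasis i)‖ |a / b|) := by
  set s := hS.isHermitian.eigenvalues with hs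
  have hs0 : ∀ i, 0 ≤ s i := hS.eigenvalues_nonneg
  set e := hS.isHermitian.eigenvectorBasis with he
  set T := Matrix.toEuclideanCLM (𝕜 := 𝕜) H with hT
  set V : Matrix (Fin n) (Fin n) 𝕜 := hS.isHermitian.eigenvectorUnitary.1 with hV
  set W : Matrix (Fin n) (Fin n) 𝕜 := V * Matrix.diagonal fun i => ((√(s i) : ℝ) : 𝕜) with hW
  have hSW : S = W * Wᴴ := by
    conv_lhs => rw [hS.isHermitian.spectral_theorem, Unitary.conjStarAlgAut_apply]
    have hD : (Matrix.diagonal fun i => ((√(s i) : ℝ) : 𝕜)) *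
        (Matrix.diagonal fun i => ((√(s i) : ℝ) : 𝕜))ᴴ = Matrix.diagonal (RCLike.ofReal ∘ s) := by
      rw [Matrix.diagonal_conjTranspose, Matrix.diagonal_mul_diagonal]
      congr 1
      ext i
      simp only [Function.comp, Pi.star_apply, RCLike.star_def, RCLike.conj_ofReal]
      rw [← RCLike.ofReal_mul, Real.mul_self_sqrt (hs0 i)]
    rw [hW, Matrix.conjTranspose_mul, ← mul_assoc,
      mul_assoc V (Matrix.diagonal fun i => ((√(s i) : ℝ) : 𝕜)), hD]
    rfl
  set N := noiseCov b σ H with hN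
  have hNpd : N.PosDef := posDef_noiseCov b hσ H
  set G := channelMatrix a b H with hG
  have hNdet : 0 < N.det := hNpd.det_pos
  have hNu : IsUnit N.det := isUnit_iff_ne_zero.mpr hNdet.ne'
  -- Sylvester's determinant identity moves the ratio to the input side, where diagonal entries are
  -- indexed by the eigenvectors of `S`.
  set M := 1 + (G * W)ᴴ * N⁻¹ * (G * W) with hM
  have hMpd : M.PosDef := Matrix.PosDef.one.add_posSemidef
    (hNpd.inv.posSemidef.conjTranspose_mul_mul_same _)
  have hdet : (G * S * Gᴴ + N).det = N.det * M.det := by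
    rw [hM, ← Matrix.det_add_mul _ _ hNu, add_comm, hSW, Matrix.conjTranspose_mul G W]
    simp only [mul_assoc]
  have hNre := RCLike.pos_iff.mp hNdet
  have hratio : RCLike.re (G * S * Gᴴ + N).det / RCLike.re N.det = RCLike.re M.det := by
    rw [hdet, RCLike.mul_re, hNre.2, zero_mul, sub_zero, mul_div_cancel_left₀ _ hNre.1.ne']
  set F : Fin n → ℝ := fun i => alignedFactor a b (min ‖T (e i)‖ |a / b|) with hF
  have hF0 : ∀ i, 0 ≤ F i := fun i => alignedFactor_nonneg _ _ _
  have hMii : ∀ i, RCLike.re (M i i) ≤ 1 + s i / σ ^ 2 * F i := by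
    intro i
    set v : Fin n → 𝕜 := G *ᵥ (e i) with hv
    set z : Fin n → 𝕜 := N⁻¹ *ᵥ v with hz
    have hcol : (fun k => (G * W) k i) = ((√(s i) : ℝ) : 𝕜) • v := by
      ext k
      rw [hW, ← mul_assoc, Matrix.mul_diagonal, Matrix.mul_apply, hv, Pi.smul_apply, smul_eq_mul,
        mul_comm]
      rfl
    have hMi : M i i = 1 + ((s i : ℝ) : 𝕜) * (star v ⬝ᵥ z) := by
      rw [hM, Matrix.add_apply, Matrix.one_apply_eq, conjTranspose_mul_mul_diag, hcol, star_smul,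
        Matrix.mulVec_smul, smul_dotProduct, dotProduct_smul, smul_smul, smul_eq_mul, RCLike.star_def,
        RCLike.conj_ofReal, ← RCLike.ofReal_mul, Real.mul_self_sqrt (hs0 i)]
    have hvT : WithLp.toLp 2 v = e i + ((a * b : ℝ) : 𝕜) • T (e i) := by
      ext k
      simp [hv, hG, channelMatrix, hT, Matrix.add_mulVec, Matrix.smul_mulVec]
    have hzN : ((σ ^ 2 : ℝ) : 𝕜) • (WithLp.toLp 2 z +
        ((b ^ 2 : ℝ) : 𝕜) • T (ContinuousLinearMap.adjoint T (WithLp.toLp 2 z))) =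
        e i + ((a * b : ℝ) : 𝕜) • T (e i) := by
      have hadj : ContinuousLinearMap.adjoint T = Matrix.toEuclideanCLM (𝕜 := 𝕜) Hᴴ := by
        rw [← ContinuousLinearMap.star_eq_adjoint, hT, ← map_star]; rfl
      have hNz : N *ᵥ z = v := by
        rw [hz, Matrix.mulVec_mulVec, Matrix.mul_nonsing_inv _ hNu, Matrix.one_mulVec]
      rw [← hvT, hadj, hT, Matrix.toEuclideanCLM_toLp, Matrix.toEuclideanCLM_toLp, ← hNz, hN, noiseCov]
      ext k
      simp [Matrix.add_mulVec, Matrix.smul_mulVec, Matrix.mulVec_mulVec]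
    have hmain := re_inner_whitened_le a b hσ T (e.norm_eq_one i) hzN
    rw [← hvT, EuclideanSpace.inner_eq_star_dotProduct] at hmain
    rw [hMi, map_add, RCLike.one_re, RCLike.re_ofReal_mul, dotProduct_comm]
    have := mul_le_mul_of_nonneg_left hmain (hs0 i)
    refine add_le_add le_rfl (this.trans_eq ?_)
    rw [hF]; ring
  have hdetM : RCLike.re M.det ≤ ∏ i, (1 + s i / σ ^ 2 * F i) :=
    (re_det_le_prod_diag hMpd).trans (Finset.prod_le_prod
      (fun i _ => (RCLike.pos_iff.mp hMpd.diag_pos).1.le) fun i _ => hMii i)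
  have hlog : Real.log (RCLike.re M.det) ≤ ∑ i, Real.log (1 + s i / σ ^ 2 * F i) := by
    rw [← Real.log_prod fun i _ => ?_]
    · exact Real.log_le_log (RCLike.pos_iff.mp hMpd.det_pos).1 hdetM
    · have := hs0 i
      have := hF0 i
      positivity
  rw [blockRate, hratio]
  calc 1 / (2 * (n : ℝ)) * Real.log (RCLike.re M.det)
      ≤ 1 / (2 * (n : ℝ)) * ∑ i, Real.log (1 + s i / σ ^ 2 * F i) := by gcongr
    _ = _ := by
      rw [Finset.mul_sum, Finset.mul_sum]
      refine Finset.sum_congr rfl fun i _ => ?_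
      rw [pointRate, gaussCap, ← mul_assoc, one_div_mul_one_div, mul_comm (n : ℝ)]

/-- `a² S + σ² I` is diagonal in the eigenbasis of `S`, so the relay power splits over the same
modes as the rate bound. -/
lemma relay_power_eq_sum {𝕜 : Type*} [RCLike 𝕜] (a σ : ℝ) {n : ℕ} {S : Matrix (Fin n) (Fin n) 𝕜}
    (hS : S.IsHermitian) (H : Matrix (Fin n) (Fin n) 𝕜) :
    RCLike.re (H * (((a ^ 2 : ℝ) : 𝕜) • S + ((σ ^ 2 : ℝ) : 𝕜) • 1) * Hᴴ).trace =
      ∑ i, (a ^ 2 * hS.eigenvalues i + σ ^ 2) *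
        ‖Matrix.toEuclideanCLM (𝕜 := 𝕜) H (hS.eigenvectorBasis i)‖ ^ 2 := by
  set V : Matrix (Fin n) (Fin n) 𝕜 := hS.eigenvectorUnitary.1 with hV
  have hVV : V * Vᴴ = 1 := Unitary.mul_star_self_of_mem hS.eigenvectorUnitary.2
  have hD : ((a ^ 2 : ℝ) : 𝕜) • S + ((σ ^ 2 : ℝ) : 𝕜) • (1 : Matrix (Fin n) (Fin n) 𝕜) =
      V * Matrix.diagonal (fun i => ((a ^ 2 * hS.eigenvalues i + σ ^ 2 : ℝ) : 𝕜)) * Vᴴ := by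
    have h1 : (Matrix.diagonal fun i => ((a ^ 2 * hS.eigenvalues i + σ ^ 2 : ℝ) : 𝕜)) =
        ((a ^ 2 : ℝ) : 𝕜) • Matrix.diagonal (RCLike.ofReal ∘ hS.eigenvalues) +
          ((σ ^ 2 : ℝ) : 𝕜) • (1 : Matrix (Fin n) (Fin n) 𝕜) := by
      rw [← Matrix.diagonal_one, ← Matrix.diagonal_smul, ← Matrix.diagonal_smul, Matrix.diagonal_add]
      congr 1; ext i; simp
    conv_lhs => rw [hS.spectral_theorem, Unitary.conjStarAlgAut_apply]
    rw [h1, Matrix.mul_add, Matrix.add_mul, Matrix.mul_smul, Matrix.smul_mul, Matrix.mul_smul,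
      Matrix.smul_mul, Matrix.mul_one, hVV]
    rfl
  have hcol : ∀ k i, (H * V) k i =
      (Matrix.toEuclideanCLM (𝕜 := 𝕜) H (hS.eigenvectorBasis i)) k := fun k i => by
    rw [Matrix.mul_apply]; rfl
  rw [hD, show H * (V * Matrix.diagonal (fun i => ((a ^ 2 * hS.eigenvalues i + σ ^ 2 : ℝ) : 𝕜)) * Vᴴ) * Hᴴ
      = (H * V) * Matrix.diagonal (fun i => ((a ^ 2 * hS.eigenvalues i + σ ^ 2 : ℝ) : 𝕜)) * (H * V)ᴴ by
    rw [Matrix.conjTranspose_mul]; simp only [mul_assoc], Matrix.trace_mul_comm, ← mul_assoc,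
    Matrix.trace, map_sum]
  refine Finset.sum_congr rfl fun i _ => ?_
  rw [Matrix.diag_apply, Matrix.mul_diagonal, Matrix.mul_apply, mul_comm, RCLike.re_ofReal_mul,
    EuclideanSpace.norm_sq_eq, map_sum]
  congr 1
  refine Finset.sum_congr rfl fun k _ => ?_
  rw [Matrix.conjTranspose_apply, hcol, RCLike.star_def, RCLike.conj_mul, ← RCLike.ofReal_pow,
    RCLike.ofReal_re]

/-- No admissible pair of any block length has a rate above the bound. -/
lemma IsRateBound.blockRate_le {𝕜 : Type*} [RCLike 𝕜] {a b σ P γ c : ℝ}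
    (hc : IsRateBound a b σ P γ c) (hσ : 0 < σ) {n : ℕ} (hn : 0 < n)
    {S H : Matrix (Fin n) (Fin n) 𝕜} (h : Admissible a σ P γ n S H) : blockRate a b σ S H ≤ c := by
  have hn' : (0 : ℝ) < n := by exact_mod_cast hn
  refine (blockRate_le_sum a b hσ h.posSemidef H).trans ?_
  rw [Finset.mul_sum]
  refine hc.sum_le (fun _ => by positivity) ?_ h.posSemidef.eigenvalues_nonneg
    (fun _ => norm_nonneg _) ?_ ?_
  · simp [hn'.ne']
  · have h1 := h.source_power
    rw [h.posSemidef.isHermitian.trace_eq_sum_eigenvalues, map_sum] at h1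
    simp only [RCLike.ofReal_re] at h1
    rw [← Finset.mul_sum, one_div, inv_mul_le_iff₀ hn']
    exact h1
  · have h1 := h.relay_power
    rw [relay_power_eq_sum a σ h.posSemidef.isHermitian] at h1
    rw [← Finset.mul_sum, one_div, inv_mul_le_iff₀ hn']
    exact h1

/-! ### Toeplitz matrices with a common eigenbasis -/

/-- Frequencies `π (2k + 1 - n) / n`, symmetric under reversal of the index. -/
def gridFreq (n : ℕ) (k : Fin n) : ℝ := Real.pi * (2 * k + 1 - n) / n

/-- Autocovariance with spectral values `v` on the grid. -/
def gridCoeff {n : ℕ} (v : Fin n → ℝ) (d : ℤ) : ℝ := 1 / n * ∑ k, v k * Real.cos (gridFreq n k * d)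

/-- Real Toeplitz matrix with eigenvalues `v`, for `v` symmetric under reversal. -/
def gridToeplitz {n : ℕ} (v : Fin n → ℝ) : Matrix (Fin n) (Fin n) ℝ := toeplitz (gridCoeff v) n

/-- Unitary matrix of the eigenvectors of `gridToeplitz`. -/
def gridUnitary (n : ℕ) : Matrix (Fin n) (Fin n) ℂ :=
  Matrix.of fun i k => Complex.exp ((gridFreq n k * (i : ℕ) : ℝ) * Complex.I) / (√n : ℝ)

lemma gridFreq_rev {n : ℕ} (k : Fin n) : gridFreq n k.rev = -gridFreq n k := by
  have : ((k.rev : ℕ) : ℝ) = n - 1 - (k : ℕ) := by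
    rw [Fin.val_rev, Nat.cast_sub (by omega)]; push_cast; ring
  rw [gridFreq, gridFreq, this]; ring

/-- Dependence on `i - j` alone is what makes every matrix diagonal in this basis Toeplitz. -/
lemma gridUnitary_mul_star {n : ℕ} (i j k : Fin n) (x : ℂ) :
    gridUnitary n i k * x * star (gridUnitary n j k) =
      1 / n * (x * Complex.exp ((gridFreq n k * (((i : ℕ) : ℤ) - ((j : ℕ) : ℤ) : ℤ) : ℝ) * Complex.I)) := by
  have hsq : ((√n : ℝ) : ℂ) * ((√n : ℝ) : ℂ) = n := by
    rw [← Complex.ofReal_mul, Real.mul_self_sqrt (Nat.cast_nonneg n)]; simp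
  have hconj : star (Complex.exp ((gridFreq n k * (j : ℕ) : ℝ) * Complex.I)) =
      Complex.exp (-((gridFreq n k * (j : ℕ) : ℝ) * Complex.I)) := by
    rw [Complex.star_def, ← Complex.exp_conj, map_mul, Complex.conj_ofReal, Complex.conj_I, mul_neg]
  simp only [gridUnitary, Matrix.of_apply, star_div₀, hconj]
  rw [show star ((√n : ℝ) : ℂ) = ((√n : ℝ) : ℂ) from Complex.conj_ofReal _]
  rw [← hsq, show ∀ u v r : ℂ, u / r * x * (v / r) = 1 / (r * r) * (x * (u * v)) by
    intro u v r; ring, ← Complex.exp_add]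
  congr 4
  push_cast; ring

/-- A geometric sum whose ratio is an `n`-th root of unity, different from `1` because `n` does not
divide `d`. -/
lemma sum_exp_gridFreq {n : ℕ} (hn : 0 < n) {d : ℤ} (hd : d ≠ 0) (hdn : |d| < n) :
    ∑ k : Fin n, Complex.exp ((gridFreq n k * d : ℝ) * Complex.I) = 0 := by
  have hn' : (n : ℂ) ≠ 0 := by exact_mod_cast hn.ne'
  set ζ := Complex.exp (2 * Real.pi * Complex.I * (d / n)) with hζ
  set ξ := Complex.exp (Real.pi * (1 - n) / n * d * Complex.I) with hξ
  have hterm : ∀ k : Fin n, Complex.exp ((gridFreq n k * d : ℝ) * Complex.I) = ξ * ζ ^ (k : ℕ) := by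
    intro k
    rw [hζ, hξ, ← Complex.exp_nat_mul, ← Complex.exp_add, gridFreq]
    congr 1
    push_cast
    field_simp
    ring
  have hζn : ζ ^ n = 1 := by
    rw [hζ, ← Complex.exp_nat_mul, Complex.exp_eq_one_iff]
    exact ⟨d, by field_simp⟩
  have hζ1 : ζ ≠ 1 := by
    rw [hζ, Ne, Complex.exp_eq_one_iff]
    rintro ⟨m, hm⟩
    have hI := Complex.two_pi_I_ne_zero
    rw [mul_comm (m : ℂ)] at hm
    have h1 := mul_left_cancel₀ hI hm
    rw [div_eq_iff hn'] at h1
    have h2 : d = m * n := by exact_mod_cast h1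
    have h3 : (n : ℤ) ∣ d := ⟨m, by rw [h2]; ring⟩
    exact hd (Int.eq_zero_of_abs_lt_dvd h3 hdn)
  simp only [hterm]
  rw [← Finset.mul_sum, Fin.sum_univ_eq_sum_range (fun k => ζ ^ k), geom_sum_eq hζ1, hζn]
  simp

lemma gridUnitary_mul_conjTranspose {n : ℕ} (hn : 0 < n) :
    gridUnitary n * (gridUnitary n)ᴴ = 1 := by
  have hn' : (n : ℂ) ≠ 0 := by exact_mod_cast hn.ne'
  ext i j
  rw [Matrix.mul_apply]
  have : ∀ k, gridUnitary n i k * (gridUnitary n)ᴴ k j = 1 / n * (1 *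
      Complex.exp ((gridFreq n k * (((i : ℕ) : ℤ) - ((j : ℕ) : ℤ) : ℤ) : ℝ) * Complex.I)) := fun k => by
    rw [← gridUnitary_mul_star, mul_one, Matrix.conjTranspose_apply]
  simp only [this, one_mul]
  rw [← Finset.mul_sum]
  rcases eq_or_ne i j with rfl | hij
  · simp [hn']
  · rw [Matrix.one_apply_ne hij, sum_exp_gridFreq hn, mul_zero]
    · intro h; exact hij (Fin.ext (by omega))
    · rw [abs_lt]; omega

/-- Reversal negates frequencies, so for symmetric `v` the sine parts cancel and a real cosine sum
remains. -/
lemma map_gridToeplitz {n : ℕ} {v : Fin n → ℝ} (hv : ∀ k, v k.rev = v k) :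
    (gridToeplitz v).map Complex.ofReal =
      gridUnitary n * Matrix.diagonal (fun k => (v k : ℂ)) * (gridUnitary n)ᴴ := by
  ext i j
  set d : ℤ := ((i : ℕ) : ℤ) - ((j : ℕ) : ℤ) with hd
  have hsin : ∑ k, v k * Real.sin (gridFreq n k * d) = 0 := by
    have h := Equiv.sum_comp Fin.revPerm fun k => v k * Real.sin (gridFreq n k * d)
    simp only [Fin.revPerm_apply, hv, gridFreq_rev, neg_mul, Real.sin_neg, mul_neg,
      Finset.sum_neg_distrib] at h
    linarith
  rw [Matrix.mul_apply]
  simp only [Matrix.mul_diagonal, Matrix.conjTranspose_apply, gridUnitary_mul_star]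
  rw [← Finset.mul_sum, ← hd]
  simp only [Complex.exp_mul_I, mul_add, Finset.sum_add_distrib]
  rw [Matrix.map_apply, gridToeplitz, toeplitz, Matrix.of_apply, gridCoeff, ← hd]
  have h2 : ∑ k, (v k : ℂ) * (Complex.sin ((gridFreq n k * d : ℝ) : ℂ) * Complex.I) = 0 := by
    have := congrArg (fun x : ℝ => (x : ℂ) * Complex.I) hsin
    simp only [Complex.ofReal_zero, zero_mul, Complex.ofReal_sum, Finset.sum_mul, Complex.ofReal_mul,
      Complex.ofReal_sin] at this
    simpa only [Complex.ofReal_mul, mul_assoc] using this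
  rw [h2, mul_zero, add_zero]
  push_cast
  rfl

section Grid

variable {n : ℕ} (hn : 0 < n) {v w : Fin n → ℝ} (hv : ∀ k, v k.rev = v k) (hw : ∀ k, w k.rev = w k)

lemma map_ofReal_injective :
    Function.Injective fun A : Matrix (Fin n) (Fin n) ℝ => A.map Complex.ofReal :=
  Matrix.map_injective Complex.ofReal_injective

include hn in
lemma conjTranspose_gridUnitary_mul : (gridUnitary n)ᴴ * gridUnitary n = 1 :=
  mul_eq_one_comm.mp (gridUnitary_mul_conjTranspose hn)

include hn in
lemma gridToeplitz_one : gridToeplitz (fun _ : Fin n => (1 : ℝ)) = 1 := by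
  apply map_ofReal_injective
  dsimp only
  rw [map_gridToeplitz fun _ => rfl, Matrix.map_one _ Complex.ofReal_zero Complex.ofReal_one]
  simp only [Complex.ofReal_one, Matrix.diagonal_one, mul_one]
  exact gridUnitary_mul_conjTranspose hn

include hn hv hw in
lemma gridToeplitz_mul : gridToeplitz v * gridToeplitz w = gridToeplitz fun k => v k * w k := by
  apply map_ofReal_injective
  dsimp only
  rw [map_gridToeplitz fun k => by rw [hv, hw]]
  have : (gridToeplitz v * gridToeplitz w).map Complex.ofReal =
      (gridToeplitz v).map Complex.ofReal * (gridToeplitz w).map Complex.ofReal :=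
    Matrix.map_mul (f := Complex.ofRealHom)
  rw [this, map_gridToeplitz hv, map_gridToeplitz hw]
  simp only [Complex.ofReal_mul]
  rw [← Matrix.diagonal_mul_diagonal]
  simp only [mul_assoc]
  rw [← mul_assoc (gridUnitary n)ᴴ (gridUnitary n), conjTranspose_gridUnitary_mul hn, one_mul]

lemma gridToeplitz_add : gridToeplitz v + gridToeplitz w = gridToeplitz fun k => v k + w k := by
  ext i j
  simp only [gridToeplitz, toeplitz, gridCoeff, Matrix.add_apply, Matrix.of_apply, add_mul,
    Finset.sum_add_distrib, mul_add]

lemma smul_gridToeplitz (r : ℝ) : r • gridToeplitz v = gridToeplitz fun k => r * v k := by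
  ext i j
  simp only [gridToeplitz, toeplitz, gridCoeff, Matrix.smul_apply, Matrix.of_apply, smul_eq_mul,
    mul_assoc, ← Finset.mul_sum]
  ring

lemma conjTranspose_gridToeplitz : (gridToeplitz v)ᴴ = gridToeplitz v := by
  ext i j
  simp only [gridToeplitz, toeplitz, gridCoeff, Matrix.conjTranspose_apply, Matrix.of_apply, star_trivial]
  congr 1
  refine Finset.sum_congr rfl fun k _ => ?_
  rw [← Real.cos_neg]
  congr 2
  push_cast; ring

include hn hv in
lemma det_gridToeplitz : (gridToeplitz v).det = ∏ k, v k := by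
  apply Complex.ofReal_injective
  have h1 : (((gridToeplitz v).det : ℝ) : ℂ) = ((gridToeplitz v).map Complex.ofReal).det :=
    Complex.ofRealHom.map_det _
  have h2 : (gridUnitary n).det * (gridUnitary n)ᴴ.det = 1 := by
    rw [← Matrix.det_mul, gridUnitary_mul_conjTranspose hn, Matrix.det_one]
  rw [h1, map_gridToeplitz hv, Matrix.det_mul, Matrix.det_mul, mul_right_comm, h2, one_mul,
    Matrix.det_diagonal]
  push_cast; rfl

include hn in
lemma trace_gridToeplitz : (gridToeplitz v).trace = ∑ k, v k := by
  have hn' : (n : ℝ) ≠ 0 := by exact_mod_cast hn.ne'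
  simp only [Matrix.trace, Matrix.diag_apply, gridToeplitz, toeplitz, gridCoeff, Matrix.of_apply,
    sub_self, Int.cast_zero, mul_zero, Real.cos_zero, mul_one]
  simp [hn']

include hn hv in
lemma posSemidef_gridToeplitz (h0 : ∀ k, 0 ≤ v k) : (gridToeplitz v).PosSemidef := by
  have : gridToeplitz v = gridToeplitz (fun k => √(v k)) * (gridToeplitz fun k => √(v k))ᴴ := by
    rw [conjTranspose_gridToeplitz, gridToeplitz_mul hn (fun k => by rw [hv]) (fun k => by rw [hv])]
    congr 1; ext k; rw [Real.mul_self_sqrt (h0 k)]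
  rw [this]
  exact Matrix.posSemidef_self_mul_conjTranspose _

/-- An `n × n` section sees only lags below `n`, so the filter can be cut off to finite length. -/
lemma exists_stable_gridToeplitz :
    ∃ h : ℤ → ℝ, (Summable fun j => ‖h j‖) ∧ gridToeplitz v = toeplitz h n := by
  refine ⟨fun d => if |d| < n then gridCoeff v d else 0, ?_, ?_⟩
  · refine summable_of_hasFiniteSupport ((Set.finite_Ioo (-(n : ℤ)) n).subset fun d hd => ?_)
    by_contra hd'
    have : ¬ |d| < n := by rwa [abs_lt]
    simp [this] at hd
  · ext i j
    have : |((i : ℕ) : ℤ) - ((j : ℕ) : ℤ)| < n := by rw [abs_lt]; omega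
    simp [gridToeplitz, toeplitz, this]

end Grid

/-- Power allocations and gains on the grid give admissible pairs, with the expected rate. -/
lemma admissible_gridToeplitz (a b : ℝ) {σ P γ : ℝ} (hσ : 0 < σ) {n : ℕ} (hn : 0 < n) {s l : Fin n → ℝ}
    (hs : ∀ k, s k.rev = s k) (hl : ∀ k, l k.rev = l k) (hs0 : ∀ k, 0 ≤ s k)
    (hp : ∑ k, s k ≤ n * P) (hq : ∑ k, (a ^ 2 * s k + σ ^ 2) * l k ^ 2 ≤ n * (γ * P)) :
    Admissible a σ P γ n (gridToeplitz s) (gridToeplitz l) ∧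
      blockRate a b σ (gridToeplitz s) (gridToeplitz l) =
        1 / n * ∑ k, gaussCap (s k / σ ^ 2 * iafFactor a b (l k)) := by
  have h1 := gridToeplitz_one hn
  refine ⟨⟨⟨_, rfl⟩, posSemidef_gridToeplitz hn hs hs0, exists_stable_gridToeplitz, ?_, ?_⟩, ?_⟩
  · rw [trace_gridToeplitz hn]; exact hp
  · refine le_trans (le_of_eq ?_) hq
    simp only [RCLike.ofReal_real_eq_id, id, RCLike.re_to_real]
    rw [← h1, smul_gridToeplitz, smul_gridToeplitz, gridToeplitz_add, conjTranspose_gridToeplitz,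
      gridToeplitz_mul hn hl (fun k => by rw [hs]), gridToeplitz_mul hn (fun k => by rw [hl, hs]) hl,
      trace_gridToeplitz hn]
    exact Finset.sum_congr rfl fun k _ => by ring
  · have hN : noiseCov b σ (gridToeplitz l) = gridToeplitz fun k => σ ^ 2 * (1 + b ^ 2 * (l k * l k)) := by
      simp only [noiseCov, RCLike.ofReal_real_eq_id, id]
      rw [← h1, conjTranspose_gridToeplitz, gridToeplitz_mul hn hl hl, smul_gridToeplitz,
        gridToeplitz_add, smul_gridToeplitz]
    have hG : channelMatrix a b (gridToeplitz l) = gridToeplitz fun k => 1 + a * b * l k := by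
      simp only [channelMatrix, RCLike.ofReal_real_eq_id, id]
      rw [← h1, smul_gridToeplitz, gridToeplitz_add]
    have hpos : ∀ k, 0 < σ ^ 2 * (1 + b ^ 2 * (l k * l k)) := fun k => by
      have := mul_self_nonneg (l k); positivity
    rw [blockRate, hN, hG, conjTranspose_gridToeplitz, gridToeplitz_mul hn (fun k => by rw [hl]) hs,
      gridToeplitz_mul hn (fun k => by rw [hl, hs]) (fun k => by rw [hl]), gridToeplitz_add,
      det_gridToeplitz hn (fun k => by rw [hl, hs]), det_gridToeplitz hn (fun k => by rw [hl]),
      RCLike.re_to_real, RCLike.re_to_real, ← Finset.prod_div_distrib, Real.log_prod fun k _ => ?_,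
      Finset.mul_sum, Finset.mul_sum]
    · refine Finset.sum_congr rfl fun k _ => ?_
      rw [gaussCap, iafFactor_real, ← mul_assoc (1 / (n : ℝ)), one_div_mul_one_div, mul_comm (n : ℝ)]
      congr 2
      have := hpos k
      have h2 : 0 < 1 + b ^ 2 * l k ^ 2 := by positivity
      field_simp
      ring
    · have := hs0 k
      have h3 : 0 ≤ (1 + a * b * l k) * s k * (1 + a * b * l k) := by
        rw [mul_right_comm]; exact mul_nonneg (mul_self_nonneg _) this
      have := hpos k
      positivity

/-! ### Achievability -/

/-- Distribute `L j` copies of each mode `j` over `q` slots. -/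
lemma exists_assignment {ι : Type*} [Fintype ι] {L : ι → ℕ} {q : ℕ} (hL : ∑ j, L j ≤ q) :
    ∃ A : ℕ → Option ι, ∀ G : Option ι → ℝ, G none = 0 →
      ∑ i ∈ Finset.range q, G (A i) = ∑ j, L j * G (some j) := by
  have hcard : Fintype.card (Σ j, Fin (L j)) ≤ Fintype.card (Fin q) := by simpa using hL
  obtain ⟨e⟩ := Function.Embedding.nonempty_of_card_le hcard
  classical
  refine ⟨fun i => if h : ∃ x, ((e x : Fin q) : ℕ) = i then some h.choose.1 else none, fun G hG => ?_⟩
  rw [← Fin.sum_univ_eq_sum_range (fun i => G (if h : ∃ x, ((e x : Fin q) : ℕ) = i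
    then some h.choose.1 else none)), ← Fintype.sum_of_injective e e.injective (fun x => G (some x.1))]
  · rw [Fintype.sum_sigma]; simp
  · intro i hi
    rw [dif_neg, hG]
    rintro ⟨x, hx⟩
    exact hi ⟨x, Fin.ext hx⟩
  · intro x
    have h : ∃ y, ((e y : Fin q) : ℕ) = (e x : Fin q) := ⟨x, rfl⟩
    rw [dif_pos h, e.injective (Fin.ext h.choose_spec)]

/-- A symmetric distribution of modes over `n` slots, mode `j` being used `2 L j` times. -/
lemma exists_symmetric_assignment {ι : Type*} [Fintype ι] {L : ι → ℕ} {n : ℕ}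
    (hL : ∑ j, L j ≤ n / 2) :
    ∃ A : Fin n → Option ι, (∀ k, A k.rev = A k) ∧ ∀ G : Option ι → ℝ, G none = 0 →
      ∑ k, G (A k) = ∑ j, 2 * L j * G (some j) := by
  obtain ⟨A, hA⟩ := exists_assignment hL
  -- The lower half is mirrored onto the upper half; for odd `n` the middle frequency stays idle.
  refine ⟨fun k => if (k : ℕ) < n / 2 then A k else if (k.rev : ℕ) < n / 2 then A k.rev else none,
    fun k => ?_, fun G hG => ?_⟩
  · have h := Fin.val_rev k
    have hk := k.2
    simp only [Fin.rev_rev]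
    split_ifs with h1 h2 <;> first | rfl | omega
  · set f : Fin n → ℝ := fun k => if (k : ℕ) < n / 2 then G (A k) else 0 with hf
    have h1 : ∀ k : Fin n, G (if (k : ℕ) < n / 2 then A k else if (k.rev : ℕ) < n / 2 then A k.rev
        else none) = f k + f k.rev := by
      intro k
      have h := Fin.val_rev k
      have hk := k.2
      simp only [hf]
      split_ifs with h1 h2 <;> first | omega | simp [hG]
    have h2 : ∑ k : Fin n, f k.rev = ∑ k, f k := Equiv.sum_comp Fin.revPerm f
    have h3 : ∑ k, f k = ∑ i ∈ Finset.range (n / 2), G (A i) := by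
      rw [hf, Fin.sum_univ_eq_sum_range (fun i => if i < n / 2 then G (A i) else 0), ← Finset.sum_filter]
      congr 1
      ext i
      simp only [Finset.mem_filter, Finset.mem_range]
      omega
    simp only [h1]
    rw [Finset.sum_add_distrib, h2, h3, hA G hG, ← two_mul, Finset.mul_sum]
    exact Finset.sum_congr rfl fun j _ => by ring

/-- Number of slots of a half block of length `n / 2` used by a mode of bandwidth `w`. -/
def slotCount (w : ℝ) (n : ℕ) : ℕ := ⌊w * ((n / 2 : ℕ) : ℝ)⌋₊

lemma two_mul_slotCount_le {w : ℝ} (hw : 0 ≤ w) (n : ℕ) : 2 * (slotCount w n : ℝ) ≤ n * w := by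
  have h1 : (slotCount w n : ℝ) ≤ w * ((n / 2 : ℕ) : ℝ) := Nat.floor_le (by positivity)
  have h2 : ((n / 2 : ℕ) : ℝ) ≤ n / 2 := Nat.cast_div_le
  nlinarith

lemma tendsto_slotCount {w : ℝ} (hw : 0 ≤ w) :
    Tendsto (fun n : ℕ => 2 * (slotCount w n : ℝ) / n) atTop (𝓝 w) := by
  have hlow : Tendsto (fun n : ℕ => w - (w + 2) / (n : ℝ)) atTop (𝓝 w) := by
    simpa using tendsto_const_nhds.sub (tendsto_const_div_atTop_nhds_zero_nat (w + 2))
  refine tendsto_of_tendsto_of_tendsto_of_le_of_le' hlow tendsto_const_nhds ?_ ?_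
  · filter_upwards [eventually_gt_atTop 0] with n hn
    have hn' : (0 : ℝ) < n := by exact_mod_cast hn
    have h1 : w * ((n / 2 : ℕ) : ℝ) < slotCount w n + 1 := Nat.lt_floor_add_one _
    have h2 : (n : ℝ) ≤ 2 * ((n / 2 : ℕ) : ℝ) + 1 := by
      have : n ≤ 2 * (n / 2) + 1 := by omega
      exact_mod_cast this
    rw [le_div_iff₀ hn', sub_mul, div_mul_cancel₀ _ hn'.ne']
    nlinarith
  · filter_upwards [eventually_gt_atTop 0] with n hn
    have hn' : (0 : ℝ) < n := by exact_mod_cast hn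
    rw [div_le_iff₀ hn', mul_comm w]
    exact two_mul_slotCount_le hw n

/-- Real admissible pairs whose rates converge to the rate of a four-mode strategy. -/
lemma exists_admissible_tendsto (a b : ℝ) {σ P γ : ℝ} (hσ : 0 < σ)
    {x : (Fin 4 → ℝ) × (Fin 4 → ℝ) × (Fin 4 → ℝ)} (hx : x ∈ fourModes a b σ P γ) :
    ∃ r : ℕ → ℝ, Tendsto r atTop (𝓝 (fourRate a b σ x)) ∧ ∀ n : ℕ, 0 < n →
      ∃ S H : Matrix (Fin n) (Fin n) ℝ, Admissible a σ P γ n S H ∧ blockRate a b σ S H = r n := by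
  obtain ⟨w, m, t⟩ := x
  obtain ⟨hw, hw1, hm, hmP, ht, -, hq⟩ := hx
  dsimp only at hw hw1 hm hmP ht hq
  refine ⟨fun n => ∑ j, 2 * (slotCount (w j) n : ℝ) / n * pointRate a b σ (m j / w j) (t j), ?_,
    fun n hn => ?_⟩
  · exact tendsto_finsetSum _ fun j _ => (tendsto_slotCount (hw j)).mul_const _
  · have hn' : (0 : ℝ) < n := by exact_mod_cast hn
    have hL : ∑ j, slotCount (w j) n ≤ n / 2 := by
      have : ∑ j, (slotCount (w j) n : ℝ) ≤ ((n / 2 : ℕ) : ℝ) := by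
        calc ∑ j, (slotCount (w j) n : ℝ) ≤ ∑ j, w j * ((n / 2 : ℕ) : ℝ) :=
              Finset.sum_le_sum fun j _ => Nat.floor_le (mul_nonneg (hw j) (Nat.cast_nonneg _))
          _ = _ := by rw [← Finset.sum_mul, hw1, one_mul]
      exact_mod_cast this
    obtain ⟨A, hArev, hA⟩ := exists_symmetric_assignment hL
    set s : Option (Fin 4) → ℝ := fun o => o.elim 0 fun j => m j / w j with hs
    set l : Option (Fin 4) → ℝ := fun o => o.elim 0 fun j => alignedGain a b (t j) with hl
    have hs0 : ∀ o, 0 ≤ s o := by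
      rintro (_ | j)
      · exact le_rfl
      · exact div_nonneg (hm j) (hw j)
    have hwm : ∀ j, w j * (m j / w j) ≤ m j := by
      intro j
      rcases eq_or_ne (w j) 0 with h0 | h0
      · rw [h0, zero_mul]; exact hm j
      · rw [mul_div_cancel₀ _ h0]
    have hmain := admissible_gridToeplitz a b (P := P) (γ := γ) hσ hn (s := fun k => s (A k))
      (l := fun k => l (A k)) (fun k => by rw [hArev]) (fun k => by rw [hArev]) (fun k => hs0 _) ?_ ?_
    · refine ⟨_, _, hmain.1, hmain.2.trans ?_⟩
      rw [hA (fun o => gaussCap (s o / σ ^ 2 * iafFactor a b (l o))) (by simp [hs, gaussCap_zero]),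
        Finset.mul_sum]
      refine Finset.sum_congr rfl fun j _ => ?_
      simp only [hs, hl, Option.elim_some, iafFactor_alignedGain, pointRate]
      ring
    · rw [hA s rfl]
      calc ∑ j, 2 * (slotCount (w j) n : ℝ) * s (some j)
          ≤ ∑ j, n * m j := by
            refine Finset.sum_le_sum fun j _ => ?_
            refine (mul_le_mul_of_nonneg_right (two_mul_slotCount_le (hw j) n) (hs0 _)).trans ?_
            rw [mul_assoc]
            exact mul_le_mul_of_nonneg_left (hwm j) hn'.le
        _ ≤ n * P := by rw [← Finset.mul_sum]; gcongr
    · rw [hA (fun o => (a ^ 2 * s o + σ ^ 2) * l o ^ 2) (by simp [hl])]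
      calc ∑ j, 2 * (slotCount (w j) n : ℝ) * ((a ^ 2 * s (some j) + σ ^ 2) * l (some j) ^ 2)
          ≤ ∑ j, n * (t j ^ 2 * (a ^ 2 * m j + σ ^ 2 * w j)) := by
            refine Finset.sum_le_sum fun j _ => ?_
            have h0 := hs0 (some j)
            refine (mul_le_mul_of_nonneg_right (two_mul_slotCount_le (hw j) n)
              (by positivity)).trans ?_
            simp only [hl, hs, Option.elim_some, alignedGain_sq]
            rw [mul_assoc]
            refine mul_le_mul_of_nonneg_left ?_ hn'.le
            rw [show w j * ((a ^ 2 * (m j / w j) + σ ^ 2) * t j ^ 2) =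
              t j ^ 2 * (a ^ 2 * (w j * (m j / w j)) + σ ^ 2 * w j) by ring]
            have := hwm j
            gcongr
        _ ≤ n * (γ * P) := by rw [← Finset.mul_sum]; gcongr

/-! ### Real pairs as complex pairs -/

lemma map_ofReal_mul {n : ℕ} (A B : Matrix (Fin n) (Fin n) ℝ) :
    (A * B).map Complex.ofReal = A.map Complex.ofReal * B.map Complex.ofReal :=
  Matrix.map_mul (f := Complex.ofRealHom)

lemma map_ofReal_add {n : ℕ} (A B : Matrix (Fin n) (Fin n) ℝ) :
    (A + B).map Complex.ofReal = A.map Complex.ofReal + B.map Complex.ofReal :=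
  Matrix.map_add _ Complex.ofReal_add _ _

lemma map_ofReal_one {n : ℕ} : (1 : Matrix (Fin n) (Fin n) ℝ).map Complex.ofReal = 1 :=
  Matrix.map_one _ Complex.ofReal_zero Complex.ofReal_one

lemma map_ofReal_smul {n : ℕ} (r : ℝ) (A : Matrix (Fin n) (Fin n) ℝ) :
    (r • A).map Complex.ofReal = (r : ℂ) • A.map Complex.ofReal := by
  ext i j; simp

lemma map_ofReal_conjTranspose {n : ℕ} (A : Matrix (Fin n) (Fin n) ℝ) :
    (Aᴴ).map Complex.ofReal = (A.map Complex.ofReal)ᴴ := by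
  ext i j; simp

lemma det_map_ofReal {n : ℕ} (A : Matrix (Fin n) (Fin n) ℝ) :
    (A.map Complex.ofReal).det = (A.det : ℂ) :=
  (Complex.ofRealHom.map_det A).symm

lemma trace_map_ofReal {n : ℕ} (A : Matrix (Fin n) (Fin n) ℝ) :
    (A.map Complex.ofReal).trace = (A.trace : ℂ) := by
  simp [Matrix.trace]

lemma noiseCov_map_ofReal (b σ : ℝ) {n : ℕ} (H : Matrix (Fin n) (Fin n) ℝ) :
    noiseCov b σ (H.map Complex.ofReal) = (noiseCov b σ H).map Complex.ofReal := by
  simp only [noiseCov, RCLike.ofReal_real_eq_id, id, map_ofReal_smul, map_ofReal_add, map_ofReal_one,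
    map_ofReal_mul, map_ofReal_conjTranspose]
  rfl

lemma channelMatrix_map_ofReal (a b : ℝ) {n : ℕ} (H : Matrix (Fin n) (Fin n) ℝ) :
    channelMatrix a b (H.map Complex.ofReal) = (channelMatrix a b H).map Complex.ofReal := by
  simp only [channelMatrix, RCLike.ofReal_real_eq_id, id, map_ofReal_smul, map_ofReal_add, map_ofReal_one]
  rfl

lemma blockRate_map_ofReal (a b σ : ℝ) {n : ℕ} (S H : Matrix (Fin n) (Fin n) ℝ) :
    blockRate a b σ (S.map Complex.ofReal) (H.map Complex.ofReal) = blockRate a b σ S H := by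
  rw [blockRate, blockRate, noiseCov_map_ofReal, channelMatrix_map_ofReal, ← map_ofReal_conjTranspose,
    ← map_ofReal_mul, ← map_ofReal_mul, ← map_ofReal_add, det_map_ofReal, det_map_ofReal]
  rfl

open scoped MatrixOrder in
lemma Admissible.map_ofReal {a σ P γ : ℝ} {n : ℕ} {S H : Matrix (Fin n) (Fin n) ℝ}
    (h : Admissible a σ P γ n S H) :
    Admissible a σ P γ n (S.map Complex.ofReal) (H.map Complex.ofReal) where
  stationary := by
    obtain ⟨r, rfl⟩ := h.stationary
    exact ⟨fun d => (r d : ℂ), rfl⟩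
  posSemidef := by
    -- A factorization `BᴴB` survives the embedding into complex matrices.
    obtain ⟨B, hB⟩ := CStarAlgebra.nonneg_iff_eq_star_mul_self.mp h.posSemidef.nonneg
    rw [hB, Matrix.star_eq_conjTranspose, map_ofReal_mul, map_ofReal_conjTranspose]
    exact Matrix.posSemidef_conjTranspose_mul_self _
  stable := by
    obtain ⟨r, hr, rfl⟩ := h.stable
    exact ⟨fun d => (r d : ℂ), by simpa using hr, rfl⟩
  source_power := by
    rw [trace_map_ofReal]
    exact h.source_power
  relay_power := by
    have := h.relay_power
    simp only [RCLike.ofReal_real_eq_id, id] at this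
    refine le_trans (le_of_eq ?_) this
    rw [← map_ofReal_conjTranspose, ← map_ofReal_one]
    erw [← map_ofReal_smul, ← map_ofReal_smul]
    rw [← map_ofReal_add, ← map_ofReal_mul, ← map_ofReal_mul, trace_map_ofReal]
    rfl

lemma isLTICapacity_of_isRateBound {a b σ P γ c : ℝ} (hσ : 0 < σ) (hc : IsRateBound a b σ P γ c)
    {x : (Fin 4 → ℝ) × (Fin 4 → ℝ) × (Fin 4 → ℝ)} (hx : x ∈ fourModes a b σ P γ)
    (hxc : fourRate a b σ x = c) : IsLTICapacity a b σ P γ c := by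
  obtain ⟨r, hr, hr'⟩ := exists_admissible_tendsto a b hσ hx
  set X : (n : ℕ) → Set ℝ := fun n =>
    {R : ℝ | ∃ S H : Matrix (Fin n) (Fin n) ℂ, Admissible a σ P γ n S H ∧ R = blockRate a b σ S H} with hX
  have hmem : ∀ n, 0 < n → r n ∈ X n := fun n hn => by
    obtain ⟨S, H, h, hR⟩ := hr' n hn
    exact ⟨_, _, h.map_ofReal, by rw [blockRate_map_ofReal, hR]⟩
  have hbd : ∀ n, 0 < n → c ∈ upperBounds (X n) := by
    rintro n hn _ ⟨S, H, h, rfl⟩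
    exact hc.blockRate_le hσ hn h
  have hlub : ∀ n, 0 < n → IsLUB (X n) (sSup (X n)) := fun n hn =>
    isLUB_csSup ⟨_, hmem n hn⟩ ⟨_, hbd n hn⟩
  refine ⟨fun n => sSup (X n), hlub, ?_⟩
  rw [hxc] at hr
  refine tendsto_of_tendsto_of_tendsto_of_le_of_le' hr tendsto_const_nhds ?_ ?_
  · filter_upwards [eventually_gt_atTop 0] with n hn using (hlub n hn).1 (hmem n hn)
  · filter_upwards [eventually_gt_atTop 0] with n hn using (hlub n hn).2 (hbd n hn)

/-! ### Densities of Gaussian measures -/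

lemma map_withDensity_comp {α β : Type*} [MeasurableSpace α] [MeasurableSpace β] (μ : Measure α)
    {f : α → β} (hf : Measurable f) {g : β → ℝ≥0∞} (hg : Measurable g) :
    (μ.withDensity fun x => g (f x)).map f = (μ.map f).withDensity g := by
  ext s hs
  rw [Measure.map_apply hf hs, withDensity_apply _ (hf hs), withDensity_apply _ hs,
    setLIntegral_map hs hg hf]

lemma det_ne_zero {E : Type*} [NormedAddCommGroup E] [InnerProductSpace ℝ E] (A : E ≃L[ℝ] E) :
    LinearMap.det (A : E →ₗ[ℝ] E) ≠ 0 :=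
  A.toLinearEquiv.isUnit_det'.ne_zero

section Density

variable (E : Type*) [NormedAddCommGroup E] [InnerProductSpace ℝ E] [FiniteDimensional ℝ E]
  [MeasurableSpace E] [BorelSpace E]

/-- Normalizing constant of the standard Gaussian density. -/
def gaussNorm : ℝ := ∫ x : E, Real.exp (-(1 / 2) * ‖x‖ ^ 2)

lemma integrable_exp_neg_half_norm_sq : Integrable fun x : E => Real.exp (-(1 / 2) * ‖x‖ ^ 2) := by
  have h := GaussianFourier.integrable_cexp_neg_mul_sq_norm_add (V := E) (b := (1 / 2 : ℂ))
    (by norm_num) 0 0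
  refine h.re.congr (ae_of_all _ fun x => ?_)
  have : (-(1 / 2) * (‖x‖ : ℂ) ^ 2 + 0 * ((inner ℝ (0 : E) x : ℝ) : ℂ)) =
      ((-(1 / 2) * ‖x‖ ^ 2 : ℝ) : ℂ) := by push_cast; ring
  simp only [this, ← Complex.ofReal_exp]
  exact Complex.ofReal_re _

lemma gaussNorm_pos : 0 < gaussNorm E := integral_exp_pos (integrable_exp_neg_half_norm_sq E)

lemma integral_cexp_gauss (t : E) :
    ∫ x : E, Complex.exp (-(1 / 2) * (‖x‖ : ℂ) ^ 2 + Complex.I * ((inner ℝ t x : ℝ) : ℂ)) =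
      gaussNorm E * Complex.exp (-(‖t‖ : ℂ) ^ 2 / 2) := by
  have h0 : (gaussNorm E : ℂ) = ∫ x : E, Complex.exp (-(1 / 2) * (‖x‖ : ℂ) ^ 2) := by
    rw [gaussNorm, ← integral_complex_ofReal]
    congr 1; ext x; push_cast; rfl
  rw [h0, GaussianFourier.integral_cexp_neg_mul_sq_norm_add (by norm_num),
    GaussianFourier.integral_cexp_neg_mul_sq_norm (by norm_num)]
  congr 2
  rw [Complex.I_sq]; ring

/-- Both measures have the same characteristic function. The constant is left as an integral since
it cancels in likelihood ratios. -/
lemma stdGaussian_eq_withDensity :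
    stdGaussian E = (volume : Measure E).withDensity fun x =>
      ENNReal.ofReal ((gaussNorm E)⁻¹ * Real.exp (-(1 / 2) * ‖x‖ ^ 2)) := by
  have hpos := gaussNorm_pos E
  have : IsFiniteMeasure ((volume : Measure E).withDensity fun x =>
      ENNReal.ofReal ((gaussNorm E)⁻¹ * Real.exp (-(1 / 2) * ‖x‖ ^ 2))) :=
    isFiniteMeasure_withDensity_ofReal ((integrable_exp_neg_half_norm_sq E).const_mul _).2
  refine Measure.ext_of_charFun ?_
  ext t
  rw [charFun_stdGaussian, charFun_apply, integral_withDensity_eq_integral_toReal_smul (by fun_prop)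
    (ae_of_all _ fun _ => ENNReal.ofReal_lt_top)]
  have hterm : ∀ x : E, (ENNReal.ofReal ((gaussNorm E)⁻¹ * Real.exp (-(1 / 2) * ‖x‖ ^ 2))).toReal •
      Complex.exp (((inner ℝ x t : ℝ) : ℂ) * Complex.I) = (gaussNorm E : ℂ)⁻¹ *
        Complex.exp (-(1 / 2) * (‖x‖ : ℂ) ^ 2 + Complex.I * ((inner ℝ t x : ℝ) : ℂ)) := by
    intro x
    rw [ENNReal.toReal_ofReal (by positivity), Complex.real_smul, Complex.exp_add, real_inner_comm]
    push_cast
    rw [mul_comm Complex.I, mul_assoc]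
  simp only [hterm]
  rw [integral_const_mul, integral_cexp_gauss, ← mul_assoc, inv_mul_cancel₀, one_mul]
  exact_mod_cast hpos.ne'

variable {E}

/-- Density of the image of the standard Gaussian measure under `A`. -/
def gaussDensity (A : E ≃L[ℝ] E) (y : E) : ℝ :=
  |(LinearMap.det (A : E →ₗ[ℝ] E))|⁻¹ * ((gaussNorm E)⁻¹ * Real.exp (-(1 / 2) * ‖A.symm y‖ ^ 2))

lemma gaussDensity_pos (A : E ≃L[ℝ] E) (y : E) : 0 < gaussDensity A y := by
  have := gaussNorm_pos E
  have := abs_pos.mpr (det_ne_zero A)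
  unfold gaussDensity
  positivity

lemma measurable_gaussDensity (A : E ≃L[ℝ] E) : Measurable (gaussDensity A) := by
  unfold gaussDensity
  exact Continuous.measurable (by fun_prop)

lemma map_stdGaussian_eq_withDensity (A : E ≃L[ℝ] E) :
    (stdGaussian E).map A = (volume : Measure E).withDensity fun y => ENNReal.ofReal (gaussDensity A y) := by
  have hm : Measurable fun y : E =>
      ENNReal.ofReal ((gaussNorm E)⁻¹ * Real.exp (-(1 / 2) * ‖A.symm y‖ ^ 2)) := by fun_prop
  have h1 : stdGaussian E = (volume : Measure E).withDensity fun x =>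
      (fun y => ENNReal.ofReal ((gaussNorm E)⁻¹ * Real.exp (-(1 / 2) * ‖A.symm y‖ ^ 2))) (A x) := by
    rw [stdGaussian_eq_withDensity]; simp
  have h2 : (volume : Measure E).map A =
      ENNReal.ofReal |(LinearMap.det (A : E →ₗ[ℝ] E))⁻¹| • (volume : Measure E) :=
    Measure.map_linearMap_addHaar_eq_smul_addHaar volume (det_ne_zero A)
  rw [h1, map_withDensity_comp _ A.continuous.measurable hm, h2, withDensity_smul_measure,
    ← withDensity_smul _ hm]
  congr 1
  ext y
  rw [Pi.smul_apply, smul_eq_mul, ← ENNReal.ofReal_mul (abs_nonneg _), abs_inv]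
  rfl

lemma log_gaussDensity (A : E ≃L[ℝ] E) (y : E) :
    Real.log (gaussDensity A y) = -Real.log |(LinearMap.det (A : E →ₗ[ℝ] E))| - Real.log (gaussNorm E) -
      1 / 2 * ‖A.symm y‖ ^ 2 := by
  have h1 := gaussNorm_pos E
  have h2 := abs_pos.mpr (det_ne_zero A)
  rw [gaussDensity, Real.log_mul (by positivity) (by positivity), Real.log_mul (by positivity)
    (by positivity), Real.log_inv, Real.log_inv, Real.log_exp]
  ring

lemma integrable_norm_sq_stdGaussian : Integrable (fun x : E => ‖x‖ ^ 2) (stdGaussian E) :=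
  (IsGaussian.memLp_two_id (μ := stdGaussian E)).integrable_norm_pow two_ne_zero

/-- Joint law of the input and output of a linear channel with input law `ν` and noise law `ρ`. -/
def channelLaw (ν ρ : Measure E) (G : E →L[ℝ] E) : Measure (E × E) :=
  (ν.prod ρ).map fun z => (z.1, G z.1 + z.2)

lemma measurable_channel (G : E →L[ℝ] E) : Measurable fun z : E × E => (z.1, G z.1 + z.2) := by
  fun_prop

lemma fst_channelLaw (ν ρ : Measure E) [IsProbabilityMeasure ν] [IsProbabilityMeasure ρ]
    (G : E →L[ℝ] E) : (channelLaw ν ρ G).fst = ν := by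
  rw [channelLaw, Measure.fst_map_prodMk (by fun_prop)]
  exact Measure.fst_prod

/-- Mutual information of a linear channel with Gaussian noise and Gaussian output. -/
lemma mutualInformation_channelLaw (ν : Measure E) [IsProbabilityMeasure ν] (G : E →L[ℝ] E)
    (A B : E ≃L[ℝ] E)
    (hB : (channelLaw ν ((stdGaussian E).map A) G).snd = (stdGaussian E).map B) :
    mutualInformation (channelLaw ν ((stdGaussian E).map A) G) =
      ENNReal.ofReal (Real.log |(LinearMap.det (B : E →ₗ[ℝ] E))| -
        Real.log |(LinearMap.det (A : E →ₗ[ℝ] E))|) := by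
  have hprobA : IsProbabilityMeasure ((stdGaussian E).map A) :=
    Measure.isProbabilityMeasure_map A.continuous.aemeasurable
  have hprobB : IsProbabilityMeasure ((stdGaussian E).map B) :=
    Measure.isProbabilityMeasure_map B.continuous.aemeasurable
  have hprobμ : IsProbabilityMeasure (channelLaw ν ((stdGaussian E).map A) G) :=
    Measure.isProbabilityMeasure_map (measurable_channel G).aemeasurable
  set μ := channelLaw ν ((stdGaussian E).map A) G with hμ
  have hdA := measurable_gaussDensity A
  have hdB := measurable_gaussDensity B
  set base := ν.prod (volume : Measure E) with hbase
  -- The channel is a shear over the input, so the input law needs no density and `S` may be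
  -- singular.
  have hshear : base.map (fun z : E × E => (z.1, G z.1 + z.2)) = base :=
    ((MeasurePreserving.id ν).skew_product (g := fun x y => G x + y)
      (by fun_prop) (ae_of_all _ fun x => map_add_left_eq_self volume (G x))).map_eq
  have hμd : μ = base.withDensity fun z => ENNReal.ofReal (gaussDensity A (z.2 - G z.1)) := by
    have hm : Measurable fun z : E × E => ENNReal.ofReal (gaussDensity A (z.2 - G z.1)) := by fun_prop
    rw [hμ, channelLaw, map_stdGaussian_eq_withDensity,
      prod_withDensity_right (hdA.ennreal_ofReal)]
    have h := map_withDensity_comp base (measurable_channel G) hm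
    rw [hshear] at h
    rw [← h]
    simp
    rfl
  have hνd : ν.prod ((stdGaussian E).map B) =
      base.withDensity fun z => ENNReal.ofReal (gaussDensity B z.2) := by
    rw [map_stdGaussian_eq_withDensity, prod_withDensity_right (hdB.ennreal_ofReal)]
  set ratio : E × E → ℝ := fun z => gaussDensity A (z.2 - G z.1) / gaussDensity B z.2 with hratio
  have hratm : Measurable ratio := by rw [hratio]; fun_prop
  have hμν : μ = (ν.prod ((stdGaussian E).map B)).withDensity fun z => ENNReal.ofReal (ratio z) := by
    rw [hνd, ← withDensity_mul _ (by fun_prop) (by fun_prop), hμd]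
    congr 1
    ext z
    rw [Pi.mul_apply, ← ENNReal.ofReal_mul (gaussDensity_pos B _).le, hratio]
    dsimp only
    rw [mul_div_cancel₀ _ (gaussDensity_pos B _).ne']
  have hac : μ ≪ ν.prod ((stdGaussian E).map B) := by
    rw [hμν]; exact withDensity_absolutelyContinuous _ _
  have hllr : llr μ (ν.prod ((stdGaussian E).map B)) =ᵐ[μ] fun z =>
      (Real.log |(LinearMap.det (B : E →ₗ[ℝ] E))| - Real.log |(LinearMap.det (A : E →ₗ[ℝ] E))|) +
        (1 / 2 * ‖B.symm z.2‖ ^ 2 - 1 / 2 * ‖A.symm (z.2 - G z.1)‖ ^ 2) := by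
    have h := Measure.rnDeriv_withDensity (ν.prod ((stdGaussian E).map B)) hratm.ennreal_ofReal
    rw [← hμν] at h
    filter_upwards [hac.ae_le h] with z hz
    rw [llr_def]
    dsimp only
    rw [hz, ENNReal.toReal_ofReal (div_pos (gaussDensity_pos A _) (gaussDensity_pos B _)).le,
      Real.log_div (gaussDensity_pos A _).ne' (gaussDensity_pos B _).ne', log_gaussDensity,
      log_gaussDensity]
    ring
  -- Whitened noise and whitened output are both standard Gaussian, so the quadratic terms of the
  -- log-likelihood ratio have equal means and only the determinants remain.
  have hAint : ∀ C : E ≃L[ℝ] E, Integrable (fun y => ‖C.symm y‖ ^ 2) ((stdGaussian E).map C) ∧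
      ∫ y, ‖C.symm y‖ ^ 2 ∂((stdGaussian E).map C) = ∫ x, ‖x‖ ^ 2 ∂(stdGaussian E) := by
    intro C
    have hmeas : AEStronglyMeasurable (fun y : E => ‖C.symm y‖ ^ 2) ((stdGaussian E).map C) :=
      Continuous.aestronglyMeasurable (by fun_prop)
    constructor
    · rw [integrable_map_measure hmeas C.continuous.aemeasurable]
      simpa [Function.comp_def] using integrable_norm_sq_stdGaussian (E := E)
    · rw [integral_map C.continuous.aemeasurable hmeas]
      simp
  have hBmap : μ.map Prod.snd = (stdGaussian E).map B := hB
  have hAmap : μ.map (fun z => z.2 - G z.1) = (stdGaussian E).map A := by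
    rw [hμ, channelLaw, Measure.map_map (by fun_prop) (measurable_channel G)]
    have : ((fun z : E × E => z.2 - G z.1) ∘ fun z => (z.1, G z.1 + z.2)) = Prod.snd := by
      ext z; simp
    rw [this]
    exact Measure.snd_prod
  have hcont : ∀ (C : E ≃L[ℝ] E) (m : Measure E), AEStronglyMeasurable (fun y : E => ‖C.symm y‖ ^ 2) m :=
    fun C m => Continuous.aestronglyMeasurable (by fun_prop)
  have iB : Integrable (fun z : E × E => ‖B.symm z.2‖ ^ 2) μ := by
    have := (hAint B).1
    rw [← hBmap, integrable_map_measure (hcont _ _) measurable_snd.aemeasurable] at this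
    exact this
  have iA : Integrable (fun z : E × E => ‖A.symm (z.2 - G z.1)‖ ^ 2) μ := by
    have := (hAint A).1
    rw [← hAmap, integrable_map_measure (hcont _ _) (by fun_prop)] at this
    exact this
  have eB : ∫ z, ‖B.symm z.2‖ ^ 2 ∂μ = ∫ x, ‖x‖ ^ 2 ∂(stdGaussian E) := by
    rw [← (hAint B).2, ← hBmap, integral_map measurable_snd.aemeasurable (hcont _ _)]
  have eA : ∫ z, ‖A.symm (z.2 - G z.1)‖ ^ 2 ∂μ = ∫ x, ‖x‖ ^ 2 ∂(stdGaussian E) := by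
    rw [← (hAint A).2, ← hAmap, integral_map (by fun_prop) (hcont _ _)]
  have hdiff : Integrable (fun z : E × E => 1 / 2 * ‖B.symm z.2‖ ^ 2 -
      1 / 2 * ‖A.symm (z.2 - G z.1)‖ ^ 2) μ := (iB.const_mul (1 / 2)).sub (iA.const_mul (1 / 2))
  have hint := (integrable_const (μ := μ) (Real.log |(LinearMap.det (B : E →ₗ[ℝ] E))| -
    Real.log |(LinearMap.det (A : E →ₗ[ℝ] E))|)).add hdiff
  rw [mutualInformation, hB, fst_channelLaw,
    InformationTheory.klDiv_of_ac_of_integrable hac (hint.congr hllr.symm), integral_congr_ae hllr,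
    integral_add (integrable_const _) hdiff,
    integral_sub (iB.const_mul (1 / 2)) (iA.const_mul (1 / 2)), integral_const_mul, integral_const_mul,
    eA, eB, integral_const]
  simp

end Density

/-! ### Mutual information of a block -/

section Block

variable {n : ℕ}

/-- Law of a linear combination of independent Gaussian vectors. -/
lemma map_add_multivariateGaussian {S N : Matrix (Fin n) (Fin n) ℝ} (hS : S.PosSemidef)
    (hN : N.PosSemidef) (A : Matrix (Fin n) (Fin n) ℝ) :
    ((multivariateGaussian 0 S).prod (multivariateGaussian 0 N)).map
      (fun z => Matrix.toEuclideanCLM (𝕜 := ℝ) A z.1 + z.2) =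
      multivariateGaussian 0 (A * S * Aᴴ + N) := by
  have hAS : (A * S * Aᴴ + N).PosSemidef := (hS.mul_mul_conjTranspose_same A).add hN
  set T := Matrix.toEuclideanCLM (𝕜 := ℝ) A with hT
  have hprob : IsProbabilityMeasure ((multivariateGaussian 0 S).map T) :=
    Measure.isProbabilityMeasure_map T.continuous.aemeasurable
  have hconv : ((multivariateGaussian 0 S).prod (multivariateGaussian 0 N)).map
      (fun z => T z.1 + z.2) = ((multivariateGaussian 0 S).map T) ∗ (multivariateGaussian 0 N) := by
    rw [Measure.conv, ← Measure.map_id (μ := multivariateGaussian 0 N),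
      Measure.map_prod_map _ _ T.continuous.measurable measurable_id,
      Measure.map_map (by fun_prop) (by fun_prop), Measure.map_id]
    rfl
  rw [hconv]
  refine Measure.ext_of_charFun ?_
  ext t
  rw [charFun_conv, charFun_multivariateGaussian hAS, charFun_multivariateGaussian hN]
  have hmap : charFun ((multivariateGaussian 0 S).map T) t =
      charFun (multivariateGaussian 0 S) (Matrix.toEuclideanCLM (𝕜 := ℝ) Aᴴ t) := by
    have hadj : ContinuousLinearMap.adjoint T = Matrix.toEuclideanCLM (𝕜 := ℝ) Aᴴ := by
      rw [← ContinuousLinearMap.star_eq_adjoint, hT, ← map_star]; rfl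
    rw [charFun_apply, charFun_apply, integral_map T.continuous.aemeasurable
      (Continuous.aestronglyMeasurable (by fun_prop))]
    simp only [← hadj, ContinuousLinearMap.adjoint_inner_right]
  rw [hmap, charFun_multivariateGaussian hS, ← Complex.exp_add]
  congr 1
  have hquad : (Matrix.toEuclideanCLM (𝕜 := ℝ) Aᴴ t).ofLp ⬝ᵥ
      S *ᵥ (Matrix.toEuclideanCLM (𝕜 := ℝ) Aᴴ t).ofLp = t.ofLp ⬝ᵥ (A * S * Aᴴ) *ᵥ t.ofLp := by
    have h1 : (Matrix.toEuclideanCLM (𝕜 := ℝ) Aᴴ t).ofLp = Aᴴ *ᵥ t.ofLp := rfl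
    rw [h1, Matrix.mulVec_mulVec, Matrix.conjTranspose_eq_transpose_of_trivial, Matrix.mulVec_transpose,
      ← Matrix.dotProduct_mulVec, Matrix.mulVec_mulVec, mul_assoc]
  rw [hquad, Matrix.add_mulVec, dotProduct_add]
  simp only [inner_zero_right]
  push_cast
  ring

/-- An invertible matrix as a continuous linear equivalence of Euclidean space. -/
def matrixCLE (M : Matrix (Fin n) (Fin n) ℝ) (hM : IsUnit M.det) :
    EuclideanSpace ℝ (Fin n) ≃L[ℝ] EuclideanSpace ℝ (Fin n) :=
  ContinuousLinearEquiv.equivOfInverse (Matrix.toEuclideanCLM (𝕜 := ℝ) M)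
    (Matrix.toEuclideanCLM (𝕜 := ℝ) M⁻¹)
    (fun x => by
      change (Matrix.toEuclideanCLM (𝕜 := ℝ) M⁻¹ * Matrix.toEuclideanCLM (𝕜 := ℝ) M) x = x
      rw [← map_mul, Matrix.nonsing_inv_mul _ hM, map_one]; rfl)
    (fun x => by
      change (Matrix.toEuclideanCLM (𝕜 := ℝ) M * Matrix.toEuclideanCLM (𝕜 := ℝ) M⁻¹) x = x
      rw [← map_mul, Matrix.mul_nonsing_inv _ hM, map_one]; rfl)

lemma det_matrixCLE (M : Matrix (Fin n) (Fin n) ℝ) (hM : IsUnit M.det) :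
    LinearMap.det (matrixCLE M hM : EuclideanSpace ℝ (Fin n) →ₗ[ℝ] EuclideanSpace ℝ (Fin n)) = M.det :=
  LinearMap.det_toLin (PiLp.basisFun 2 ℝ (Fin n)) M

open scoped MatrixOrder in
/-- A nondegenerate Gaussian measure as a linear image of the standard one. -/
lemma exists_multivariateGaussian_eq_map {N : Matrix (Fin n) (Fin n) ℝ} (hN : N.PosDef) :
    ∃ A : EuclideanSpace ℝ (Fin n) ≃L[ℝ] EuclideanSpace ℝ (Fin n),
      multivariateGaussian 0 N = (stdGaussian (EuclideanSpace ℝ (Fin n))).map A ∧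
      Real.log |LinearMap.det (A : EuclideanSpace ℝ (Fin n) →ₗ[ℝ] EuclideanSpace ℝ (Fin n))| =
        1 / 2 * Real.log N.det := by
  have hsq : (CFC.sqrt N).det * (CFC.sqrt N).det = N.det := by
    rw [← Matrix.det_mul, CFC.sqrt_mul_sqrt_self N hN.posSemidef.nonneg]
  have hdet : (CFC.sqrt N).det ≠ 0 := by
    intro h
    rw [h, zero_mul] at hsq
    exact hN.det_pos.ne hsq
  refine ⟨matrixCLE (CFC.sqrt N) (isUnit_iff_ne_zero.mpr hdet), ?_, ?_⟩
  · rw [multivariateGaussian]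
    congr 1
    ext x
    rw [zero_add]; rfl
  · rw [det_matrixCLE, Real.log_abs, ← hsq, Real.log_mul hdet hdet]
    ring

/-- The forwarded and local noises `b H w_r + w_d` merge into one Gaussian noise independent of the
input. -/
lemma jointLaw_eq_channelLaw (a b σ : ℝ) (S H : Matrix (Fin n) (Fin n) ℝ) :
    jointLaw a b σ S H = channelLaw (multivariateGaussian 0 S) (multivariateGaussian 0 (noiseCov b σ H))
      (Matrix.toEuclideanCLM (𝕜 := ℝ) (channelMatrix a b H)) := by
  have hI : (σ ^ 2 • (1 : Matrix (Fin n) (Fin n) ℝ)).PosSemidef :=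
    Matrix.PosSemidef.one.smul (sq_nonneg σ)
  have hN : noiseCov b σ H =
      (b • H) * (σ ^ 2 • (1 : Matrix (Fin n) (Fin n) ℝ)) * (b • H)ᴴ + σ ^ 2 • 1 := by
    simp only [noiseCov, RCLike.ofReal_real_eq_id, id, Matrix.conjTranspose_smul, star_trivial,
      Matrix.smul_mul, Matrix.mul_smul, smul_add, smul_smul, mul_one]
    rw [add_comm]
    congr 2
    ring
  rw [hN, ← map_add_multivariateGaussian hI hI, channelLaw,
    ← Measure.map_id (μ := multivariateGaussian 0 S), Measure.map_prod_map _ _ measurable_id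
      (by fun_prop), Measure.map_map (measurable_channel _) (by fun_prop), jointLaw]
  congr 1
  ext z : 1
  simp only [Function.comp, Prod.map_fst, Prod.map_snd, id, channelMatrix, RCLike.ofReal_real_eq_id,
    map_add, map_one, map_smul, add_apply, smul_apply, one_apply_eq_self, smul_add, smul_smul,
    mul_comm b a]
  congr 1
  abel

/-- The mutual information of a block is its log-determinant rate. -/
lemma mutualInformation_jointLaw (a b : ℝ) {σ : ℝ} (hσ : 0 < σ) (hn : 0 < n)
    {S : Matrix (Fin n) (Fin n) ℝ} (hS : S.PosSemidef) (H : Matrix (Fin n) (Fin n) ℝ) :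
    mutualInformation (jointLaw a b σ S H) / n = ENNReal.ofReal (blockRate a b σ S H) := by
  have hn' : (0 : ℝ) < n := by exact_mod_cast hn
  have hN := posDef_noiseCov b hσ H
  set G := channelMatrix a b H with hG
  have hY : (G * S * Gᴴ + noiseCov b σ H).PosDef :=
    Matrix.PosDef.posSemidef_add (hS.mul_mul_conjTranspose_same G) hN
  obtain ⟨A, hA, hAdet⟩ := exists_multivariateGaussian_eq_map hN
  obtain ⟨B, hB, hBdet⟩ := exists_multivariateGaussian_eq_map hY
  have hsnd : (channelLaw (multivariateGaussian 0 S)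
      ((stdGaussian (EuclideanSpace ℝ (Fin n))).map A) (Matrix.toEuclideanCLM (𝕜 := ℝ) G)).snd =
      (stdGaussian (EuclideanSpace ℝ (Fin n))).map B := by
    rw [← hA, ← hB, ← map_add_multivariateGaussian hS hN.posSemidef, channelLaw,
      Measure.snd_map_prodMk (by fun_prop)]
  rw [jointLaw_eq_channelLaw a b σ, hA, mutualInformation_channelLaw _ _ A B hsnd, hAdet, hBdet,
    ← ENNReal.ofReal_natCast, ← ENNReal.ofReal_div_of_pos hn', blockRate]
  congr 1
  simp only [RCLike.re_to_real]
  rw [Real.log_div hY.det_pos.ne' hN.det_pos.ne']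
  field_simp

end Block

lemma tendsto_blockCapacity {a b σ P γ c : ℝ} (hσ : 0 < σ) (hc : IsRateBound a b σ P γ c)
    {x : (Fin 4 → ℝ) × (Fin 4 → ℝ) × (Fin 4 → ℝ)} (hx : x ∈ fourModes a b σ P γ)
    (hxc : fourRate a b σ x = c) :
    Tendsto (blockCapacity a b σ P γ) atTop (𝓝 (ENNReal.ofReal c)) := by
  obtain ⟨r, hr, hr'⟩ := exists_admissible_tendsto a b hσ hx
  rw [hxc] at hr
  refine tendsto_of_tendsto_of_tendsto_of_le_of_le' (ENNReal.tendsto_ofReal hr) tendsto_const_nhds ?_ ?_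
  · filter_upwards [eventually_gt_atTop 0] with n hn
    obtain ⟨S, H, h, hR⟩ := hr' n hn
    rw [← hR, ← mutualInformation_jointLaw a b hσ hn h.posSemidef H, blockCapacity]
    exact le_iSup_of_le S (le_iSup_of_le H (le_iSup_of_le h le_rfl))
  · filter_upwards [eventually_gt_atTop 0] with n hn
    refine iSup_le fun S => iSup_le fun H => iSup_le fun h => ?_
    rw [mutualInformation_jointLaw a b hσ hn h.posSemidef H]
    exact ENNReal.ofReal_le_ofReal (hc.blockRate_le hσ hn h)

end LTIRelay

end

/-! ### The capacity theorem -/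

theorem corollary1 (a b σ P γ : ℝ) (hσ : 0 < σ) (hP : 0 < P) (hγ : 0 < γ) :
    ∃ C : ℝ,
      -- `C` is the capacity with complex filters, and with real filters and mutual information
      LTIRelay.IsLTICapacity a b σ P γ C ∧
      Tendsto (LTIRelay.blockCapacity a b σ P γ) atTop (𝓝 (ENNReal.ofReal C)) ∧
      -- finite-letter formula with one direct-only mode and seven real gains
      IsGreatest (LTIRelay.modeRates a b σ P γ 7) C ∧
      IsLUB (LTIRelay.modeRatesEq a b σ P γ 7) C ∧
      (b ^ 2 * (γ * P) ≤ a ^ 2 * (a ^ 2 * P + σ ^ 2) →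
        IsGreatest (LTIRelay.modeRatesEq a b σ P γ 7) C) ∧
      -- neither more modes nor complex gains help
      (∀ (m : ℕ) (τ θ : Fin (m + 1) → ℝ) (l : Fin m → ℂ), LTIRelay.IsSplit τ θ →
        LTIRelay.modeRelayPower a σ P τ θ l ≤ γ * P → LTIRelay.modeRate a b σ P τ θ l ≤ C) ∧
      -- the gains in use are roots of one polynomial of degree seven
      (b ≠ 0 → ∃ p : Polynomial ℝ, p.natDegree = 7 ∧
        (b ^ 2 * (γ * P) < a ^ 2 * (a ^ 2 * P + σ ^ 2) →
          ∃ α β : ℝ, 0 ≤ α ∧ 0 < β ∧ p = LTIRelay.gainPoly a b σ α β) ∧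
        ∀ (m : ℕ) (τ θ : Fin (m + 1) → ℝ) (l : Fin m → ℝ), LTIRelay.IsSplit τ θ →
          LTIRelay.modeRelayPower a σ P τ θ l ≤ γ * P → LTIRelay.modeRate a b σ P τ θ l = C →
          ∀ j : Fin m, 0 < τ j.succ → 0 < θ j.succ → p.IsRoot (l j)) ∧
      -- splitting the band into eight subbands achieves `C`, with gains aligned with `ab`
      ∃ (τ θ : Fin 8 → ℝ) (l : Fin 7 → ℝ), LTIRelay.IsSplit τ θ ∧
        LTIRelay.modeRelayPower a σ P τ θ l ≤ γ * P ∧ LTIRelay.modeRate a b σ P τ θ l = C ∧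
        (∀ j, 0 ≤ a * b * l j) ∧
        LTIRelay.spectralSourcePower (LTIRelay.bandStep τ fun j => θ j * P / τ j) ≤ P ∧
        LTIRelay.spectralRelayPower a σ (LTIRelay.bandStep τ fun j => θ j * P / τ j)
          (LTIRelay.bandStep τ (Fin.cons 0 l)) ≤ γ * P ∧
        LTIRelay.spectralRate a b σ (LTIRelay.bandStep τ fun j => θ j * P / τ j)
          (LTIRelay.bandStep τ (Fin.cons 0 l)) = C := by
  obtain ⟨c, hc, ⟨⟨w, m, t⟩, hx, hxc⟩, h1, h2, h3, h4⟩ := LTIRelay.exists_finiteLetter a b hσ hP hγ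
  obtain ⟨hw, hw1, hm, hmP, ht, -, hq⟩ := id hx
  have hs := LTIRelay.isSplit_seven hP le_rfl zero_le_one hw hw1 hm hmP
  have hQ : LTIRelay.modeRelayPower a σ P (LTIRelay.sevenTau 0 w) (LTIRelay.sevenTheta P m)
      (LTIRelay.sevenGain a b t 0) ≤ γ * P :=
    (LTIRelay.modeRelayPower_seven_le a b σ hP le_rfl 0 hw hm).trans (by simpa using hq)
  have hR := (LTIRelay.modeRate_seven_zero a b σ hP 0 w m t).trans hxc
  refine ⟨c, LTIRelay.isLTICapacity_of_isRateBound hσ hc hx hxc,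
    LTIRelay.tendsto_blockCapacity hσ hc hx hxc, h1, h2, h3,
    fun m τ θ l hs hQ => hc.modeRate_le hP hs hQ, h4,
    _, _, _, hs, hQ, hR, LTIRelay.sevenGain_aligned a b ht,
    LTIRelay.spectralSourcePower_bandStep hs P hP, ?_, ?_⟩
  · rw [LTIRelay.spectralRelayPower_bandStep hs]; exact hQ
  · rw [LTIRelay.spectralRate_bandStep hs]; exact hR
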